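/- Throughout, $R$ is a commutative ring with $1$, $R^*$ its group of units, $I$ an ideal of $R$, and $t,r,l,m$ are natural numbers. \textbf{Groups.} Let ${\rm SL}_2(R,I)$ be the kernel of ${\rm SL}_2(R)\to{\rm SL}_2(R/I)$. Let $G(C_2,R)={\rm Sp}_4(R)=\{A\in{\rm GL}_4(R)\mid A^TJA=J\}$ with $J=\begin{pmatrix}0&I_2\\-I_2&0\end{pmatrix}$. Its root elements are, for $x\in R$, with $E_{ij}$ the $2\times2$ matrix units: $\begin{pmatrix}I_2&xE_{ii}\\0&I_2\end{pmatrix}$, $\begin{pmatrix}I_2&0\\xE_{ii}&I_2\end{pmatrix}$ ($i=1,2$), $\begin{pmatrix}I_2&x(E_{12}+E_{21})\\0&I_2\end{pmatrix}$, $\begin{pmatrix}I_2&0\\x(E_{12}+E_{21})&I_2\end{pmatrix}$, $\begin{pmatrix}I_2+xE_{12}&0\\0&I_2-xE_{21}\end{pmatrix}$, $\begin{pmatrix}I_2+xE_{21}&0\\0&I_2-xE_{12}\end{pmatrix}$; they are denoted $\varepsilon_\phi(x)$ for the eight roots $\phi$ of $C_2$. Let $C(C_2,R,I)$ be the kernel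 of ${\rm Sp}_4(R)\to{\rm Sp}_4(R/I)$ (all of ${\rm Sp}_4(R)$ if $I=R$), and let $E(C_2,R,I)$ be the normal subgroup of ${\rm Sp}_4(R)$ generated by all $\varepsilon_\phi(x)$ with $x\in I$; it is contained in $C(C_2,R,I)$. \textbf{Stable range.} $R$ has stable range at most $m$ if whenever $a_0R+\dots+a_mR=R$ there are $x_1,\dots,x_m\in R$ with $(a_1-x_1a_0)R+\dots+(a_m-x_ma_0)R=R$. $R$ has stable range at most $3/2$ if for each non-zero $a\in R$ the ring $R/aR$ has stable range at most $1$. \textbf{Gen.} For $h\in R$ let $U(hR)$ be the unit group of $R/hR$ (trivial if $h\in R^*$). $R$ satisfies ${\rm Gen}(t,r)$ if for all $a,b\in R$ with $aR+bR=R$ there is $h\in a+bR$ such that $U(hR)/U(hR)^t$ can be generated by $r$ or fewer elements. \textbf{Exp.} Let $W(I)=\{(b,a)\in R^2\mid b\in I,\ a-1\in I,\ aR+bR=R\}$. $R$ satisfies ${\rm Exp}(t,l)$ if for every non-zero $q\in R$ and every $(b,a)\in W(qR)$ there are $a',c,d\in R$ and $u_i,f_i,g_i,b_i',d_i'\in R$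 for $1\le i\le l$ such that (a) $a'\in a+bR$; (b) $\begin{pmatrix}a'&b\\c&d\end{pmatrix}\in{\rm SL}_2(R,qR)$; (c) $\begin{pmatrix}a'&b_i'\\c&d_i'\end{pmatrix}\in{\rm SL}_2(R,qR)$ for all $i$; (d) $f_iI_2+g_i\begin{pmatrix}a'&b_i'\\c&d_i'\end{pmatrix}\in{\rm SL}_2(R,qR)$ for all $i$; (e) $\prod_{i=1}^l(f_i+g_ia')^2\in (a')^t+cR$; (f) $u_i\in R^*$ and $f_i+g_ia'\equiv u_i$ mod $b_i'R$ for all $i$. \textbf{Theorem.} Let $R$ be a commutative ring with $1$ and $I$ a non-zero ideal of $R$. Assume that $R$ has stable range at most $3/2$ and satisfies ${\rm Gen}(2,1)$, ${\rm Gen}(t,1)$ and ${\rm Exp}(t,l)$ for positive integers $t$ and $l$. Then the group $C(C_2,R,I)/E(C_2,R,I)$ is finite, of order at most $2t$. -/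

import Mathlib

open scoped Matrix MatrixGroups

namespace CongruenceQuotient

section Rings

variable (R : Type*) [CommRing R]

/-- (Bass) stable range at most `m`: whenever `a₀, a₁, …, a_m` generate the unit ideal, there are
`x₁, …, x_m` such that `a₁ - x₁ a₀, …, a_m - x_m a₀` generate the unit ideal. -/
def StableRangeLE (m : ℕ) : Prop :=
  ∀ (a₀ : R) (a : Fin m → R), Ideal.span {a₀} ⊔ Ideal.span (Set.range a) = ⊤ →
    ∃ x : Fin m → R, Ideal.span (Set.range fun i => a i - x i * a₀) = ⊤

/-- Stable range at most `3/2`: for every non-zero `a`, the ring `R/aR` has stable range at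
most `1`. -/
def StableRangeLEThreeHalves : Prop :=
  ∀ a : R, a ≠ 0 → StableRangeLE (R ⧸ Ideal.span {a}) 1

/-- The property `Gen(t,r)`: if `aR + bR = R`, there is `h ∈ a + bR` such that
`U(hR)/U(hR)^t` is generated by at most `r` elements, where `U(hR)` is the unit group of `R/hR`
(the trivial group if `h` is a unit). -/
def GenProp (t r : ℕ) : Prop :=
  ∀ a b : R, Ideal.span {a} ⊔ Ideal.span {b} = ⊤ →
    ∃ h : R, h - a ∈ Ideal.span {b} ∧
      ∃ S : Finset ((R ⧸ Ideal.span {h})ˣ ⧸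
          (powMonoidHom t : (R ⧸ Ideal.span {h})ˣ →* (R ⧸ Ideal.span {h})ˣ).range),
        S.card ≤ r ∧ Subgroup.closure {s | s ∈ S} = ⊤

variable {R}

/-- The set `W(I)` of all pairs `(b, a)` with `b ≡ 0` and `a ≡ 1` modulo `I`, and
`aR + bR = R`. -/
def W (I : Ideal R) : Set (R × R) :=
  {p | p.1 ∈ I ∧ p.2 - 1 ∈ I ∧ Ideal.span {p.2} ⊔ Ideal.span {p.1} = ⊤}

/-- The group `C(A₁, R, I) = SL₂(R, I)`: the kernel of `SL₂(R) → SL₂(R/I)`. -/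
def congruenceSL2 (I : Ideal R) : Subgroup SL(2, R) :=
  (Matrix.SpecialLinearGroup.map (n := Fin 2) (Ideal.Quotient.mk I)).ker

/-- The `2 × 2` matrix `M` is an element of `C(A₁, R, I)`. -/
def InCongruenceSL2 (I : Ideal R) (M : Matrix (Fin 2) (Fin 2) R) : Prop :=
  ∃ g ∈ congruenceSL2 I, (g : Matrix (Fin 2) (Fin 2) R) = M

variable (R)

/-- The property `Exp(t,l)`. -/
def ExpProp (t l : ℕ) : Prop :=
  ∀ q : R, q ≠ 0 → ∀ b a : R, (b, a) ∈ W (Ideal.span {q}) →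
    ∃ (a' c d : R) (u f g b' d' : Fin l → R),
      a' - a ∈ Ideal.span {b} ∧
      InCongruenceSL2 (Ideal.span {q}) !![a', b; c, d] ∧
      (∀ i, InCongruenceSL2 (Ideal.span {q}) !![a', b' i; c, d' i]) ∧
      (∀ i, InCongruenceSL2 (Ideal.span {q})
        (f i • (1 : Matrix (Fin 2) (Fin 2) R) + g i • !![a', b' i; c, d' i])) ∧
      (∏ i, (f i + g i * a') ^ 2) - a' ^ t ∈ Ideal.span {c} ∧
      ∀ i, IsUnit (u i) ∧ f i + g i * a' - u i ∈ Ideal.span {b' i}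

end Rings

section Symplectic

variable (R : Type*) [CommRing R]

/-- `G(C₂, R) = Sp₄(R)`, the `4 × 4` matrices preserving the form with block matrix
`[[0, I₂], [-I₂, 0]]`. (Mathlib uses the negative of this matrix and the equation
`A J Aᵀ = J`; both describe the same group, see `mem_Sp4_iff`.) -/
abbrev Sp4 : Type _ := Matrix.symplecticGroup (Fin 2) R

variable {R}

theorem mem_Sp4_iff (A : Matrix (Fin 2 ⊕ Fin 2) (Fin 2 ⊕ Fin 2) R) :
    A ∈ Matrix.symplecticGroup (Fin 2) R ↔
      Aᵀ * Matrix.fromBlocks 0 1 (-1) 0 * A = Matrix.fromBlocks 0 1 (-1) 0 := by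
  have h : (Matrix.fromBlocks 0 1 (-1) 0 : Matrix (Fin 2 ⊕ Fin 2) (Fin 2 ⊕ Fin 2) R)
      = -Matrix.J (Fin 2) R := by
    simp [Matrix.J, Matrix.fromBlocks_neg]
  rw [SymplecticGroup.mem_iff', h]
  simp

/-- The eight roots of `C₂`, with `e₁, e₂` the usual orthonormal basis. -/
inductive RootC2
  /-- the long root `2eᵢ` -/
  | long (i : Fin 2)
  /-- the long root `-2eᵢ` -/
  | negLong (i : Fin 2)
  /-- the short root `e₁ + e₂` -/
  | shortSum
  /-- the short root `-e₁ - e₂` -/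
  | negShortSum
  /-- the short root `e₁ - e₂` -/
  | shortDiff
  /-- the short root `e₂ - e₁` -/
  | negShortDiff

/-- The matrix of the root element `ε_φ(x)` of `Sp₄(R)`. -/
def rootMatrix (φ : RootC2) (x : R) : Matrix (Fin 2 ⊕ Fin 2) (Fin 2 ⊕ Fin 2) R :=
  match φ with
  | .long i => Matrix.fromBlocks 1 (Matrix.single i i x) 0 1
  | .negLong i => Matrix.fromBlocks 1 0 (Matrix.single i i x) 1
  | .shortSum => Matrix.fromBlocks 1 !![0, x; x, 0] 0 1
  | .negShortSum => Matrix.fromBlocks 1 0 !![0, x; x, 0] 1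
  | .shortDiff => Matrix.fromBlocks !![1, x; 0, 1] 0 0 !![1, 0; -x, 1]
  | .negShortDiff => Matrix.fromBlocks !![1, 0; x, 1] 0 0 !![1, -x; 0, 1]

theorem rootMatrix_mem (φ : RootC2) (x : R) :
    rootMatrix φ x ∈ Matrix.symplecticGroup (Fin 2) R := by
  rw [SymplecticGroup.mem_iff]
  rw [Matrix.J]
  cases φ <;>
    simp only [rootMatrix, Matrix.fromBlocks_multiply, Matrix.fromBlocks_transpose] <;>
    rw [Matrix.fromBlocks_inj] <;> refine ⟨?_, ?_, ?_, ?_⟩ <;>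
    ext i j <;> fin_cases i <;> fin_cases j <;>
    simp [Matrix.single_apply, Matrix.vecMul, dotProduct, Fin.sum_univ_two]

/-- The root element `ε_φ(x)` of `Sp₄(R)`. -/
def rootElement (φ : RootC2) (x : R) : Sp4 R :=
  ⟨rootMatrix φ x, rootMatrix_mem φ x⟩

/-- The homomorphism `Sp₄(R) → Sp₄(S)` induced by a ring homomorphism `R → S`. -/
def sp4Map {S : Type*} [CommRing S] (f : R →+* S) : Sp4 R →* Sp4 S where
  toFun A := ⟨(A : Matrix (Fin 2 ⊕ Fin 2) (Fin 2 ⊕ Fin 2) R).map f, by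
    have h := congrArg (fun M => M.map f) (SymplecticGroup.mem_iff.1 A.2)
    simp only [Matrix.map_mul, Matrix.map_J] at h
    exact SymplecticGroup.mem_iff.2 h⟩
  map_one' := by ext1; simp
  map_mul' A B := by ext1; simp [Matrix.map_mul]

/-- The principal congruence subgroup `C(C₂, R, I)`: the kernel of `Sp₄(R) → Sp₄(R/I)`
(all of `Sp₄(R)` if `I = R`). -/
def congruenceSp4 (I : Ideal R) : Subgroup (Sp4 R) :=
  (sp4Map (Ideal.Quotient.mk I)).ker

/-- The relative elementary subgroup `E(C₂, R, I)`: the normal subgroup of `Sp₄(R)` generated by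
the root elements `ε_φ(x)` with `x ∈ I`. -/
def elementarySp4 (I : Ideal R) : Subgroup (Sp4 R) :=
  Subgroup.normalClosure {A | ∃ φ : RootC2, ∃ x ∈ I, A = rootElement φ x}

instance (I : Ideal R) : (elementarySp4 I).Normal :=
  Subgroup.normalClosure_normal

theorem elementarySp4_le_congruenceSp4 (I : Ideal R) : elementarySp4 I ≤ congruenceSp4 I := by
  have : (congruenceSp4 I).Normal := MonoidHom.normal_ker _
  refine Subgroup.normalClosure_le_normal ?_
  rintro _ ⟨φ, x, hx, rfl⟩
  have hx' : Ideal.Quotient.mk I x = 0 := Ideal.Quotient.eq_zero_iff_mem.2 hx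
  refine MonoidHom.mem_ker.2 (Subtype.ext ?_)
  cases φ <;>
    ext i j <;> rcases i with i | i <;> rcases j with j | j <;>
    fin_cases i <;> fin_cases j <;>
    simp [sp4Map, rootElement, rootMatrix, hx', Matrix.single_apply, apply_ite]

/-- The quotient group `C(C₂, R, I) / E(C₂, R, I)`. -/
abbrev CongruenceQuotientSp4 (I : Ideal R) : Type _ :=
  congruenceSp4 I ⧸ (elementarySp4 I).subgroupOf (congruenceSp4 I)

end Symplectic

end CongruenceQuotient

/-!
The quotient `Q = C(C₂, R, I) / E(C₂, R, I)` is computed through two symbols, which attach classes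
in `Q` to the first columns `(a, c)` of matrices in `SL₂(R, I)`: the long symbol `[c / a]`, from the
embedding of `SL₂` in `Sp₄` belonging to the long roots `±2e₁`, and the short symbol `{c / a}`, from
the one belonging to `±(e₁ - e₂)`.

Geometry. Stable range `3/2` allows one to reduce the first column of a matrix in `C(C₂, R, I)` by
elementary operations, so that every class in `Q` is a long symbol (`exists_longEmb₁`). Matrices of
`SL₂(R, I)` normalize the Heisenberg groups attached to the other roots and act trivially on them
modulo `I`; hence all root elements centralize `Q` (`commute_longEmb₁_root`), and `Q` is commutative
because it is covered by each of two commuting long root subgroups. Consequently both symbols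
depend only on `c` modulo `aI` and on `a` modulo `cR`. A matrix identity gives
`{c / a} [c' / a] = [c² c' / a]` (`toQuot_long_mul_short`), and any non-zero `I` may be replaced by a
non-zero principal ideal `qR` inside it (`exists_surjective_quotient`).

Arithmetic. Comparing two ways to absorb squares shows that the short symbol is multiplicative in
its numerator, hence, by multiplying matrices, in its denominator. With these rules `Exp(t, l)`
gives the short symbol exponent `t` (`short_pow_eq_one`). Two symbols can be brought to a common
denominator `m` for which the units modulo `m` are generated, up to `t`-th powers, by one element.
So any two values of the short symbol lie in a common cyclic group, and these values form a cyclic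
subgroup of order at most `t`. Modulo this subgroup the long symbol ignores square factors of the
numerator, and `Gen(2, 1)` bounds its index by two.
-/

namespace CongruenceQuotient

/-! ### Counting in commutative groups -/

section Counting

theorem index_le_two_of_forall_inv_mul_mem {Q : Type*} [CommGroup Q] (H : Subgroup Q)
    (h : ∀ x y : Q, x ∉ H → y ∉ H → x⁻¹ * y ∈ H) : H.index ≠ 0 ∧ H.index ≤ 2 := by
  classical
  have key : ∃ f : Bool → Q ⧸ H, Function.Surjective f := by
    by_cases hH : ∃ z, z ∉ H
    · obtain ⟨z, hz⟩ := hH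
      refine ⟨fun b => if b then (z : Q ⧸ H) else 1, fun y => ?_⟩
      obtain ⟨y, rfl⟩ := QuotientGroup.mk_surjective y
      by_cases hy : y ∈ H
      · exact ⟨false, by simpa using ((QuotientGroup.eq_one_iff y).2 hy).symm⟩
      · exact ⟨true, by simpa using QuotientGroup.eq.2 (h z y hz hy)⟩
    · push Not at hH
      refine ⟨fun _ => 1, fun y => ?_⟩
      obtain ⟨y, rfl⟩ := QuotientGroup.mk_surjective y
      exact ⟨true, ((QuotientGroup.eq_one_iff y).2 (hH y)).symm⟩
  obtain ⟨f, hf⟩ := key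
  have : Finite (Q ⧸ H) := Finite.of_surjective f hf
  refine ⟨?_, ?_⟩
  · rw [Subgroup.index_eq_card]; exact Nat.card_pos.ne'
  · rw [Subgroup.index_eq_card]
    simpa using Nat.card_le_card_of_surjective f hf

/-- A commutative group of exponent `t` in which any two elements lie in a common cyclic subgroup
is cyclic of order at most `t`. -/
theorem card_le_of_locally_cyclic {H : Type*} [CommGroup H] {t : ℕ} (ht : 0 < t)
    (hexp : ∀ x : H, x ^ t = 1)
    (hcyc : ∀ x y : H, ∃ z : H, x ∈ Subgroup.zpowers z ∧ y ∈ Subgroup.zpowers z) :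
    Finite H ∧ Nat.card H ≤ t := by
  have hE : Monoid.ExponentExists H := ⟨t, ht, hexp⟩
  obtain ⟨g, hg⟩ := Monoid.exists_orderOf_eq_exponent hE
  have hfin : ∀ x : H, IsOfFinOrder x := fun x => isOfFinOrder_iff_pow_eq_one.2 ⟨t, ht, hexp x⟩
  have hall : ∀ y : H, y ∈ Subgroup.zpowers g := by
    intro y
    obtain ⟨z, hgz, hyz⟩ := hcyc g y
    have hle : Subgroup.zpowers g ≤ Subgroup.zpowers z := by simpa using hgz
    have hdvd : orderOf z ∣ orderOf g := hg ▸ Monoid.order_dvd_exponent z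
    have : Finite (Subgroup.zpowers z) := (hfin z).finite_zpowers
    have heq : Subgroup.zpowers g = Subgroup.zpowers z := by
      apply Subgroup.eq_of_le_of_card_ge hle
      rw [Nat.card_zpowers, Nat.card_zpowers]
      exact Nat.le_of_dvd (hfin g).orderOf_pos hdvd
    rw [heq]; exact hyz
  have : Finite (Subgroup.zpowers g) := (hfin g).finite_zpowers
  have hs : Function.Surjective (fun x : Subgroup.zpowers g => (x : H)) :=
    fun y => ⟨⟨y, hall y⟩, rfl⟩
  refine ⟨Finite.of_surjective _ hs, ?_⟩
  calc Nat.card H ≤ Nat.card (Subgroup.zpowers g) := Nat.card_le_card_of_surjective _ hs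
    _ = orderOf g := Nat.card_zpowers g
    _ ≤ t := Nat.le_of_dvd ht (orderOf_dvd_of_pow_eq_one (hexp g))

end Counting

/-! ### Stable range and the property `Gen` -/

section StableRange

variable {R : Type*} [CommRing R]

/-- The form in which stable range `3/2` is used: if `a`, `b`, `y` generate the unit ideal and
`y ≠ 0`, then some `a + x * b` is a unit modulo `y`. -/
theorem StableRangeLEThreeHalves.exists_isCoprime (hsr : StableRangeLEThreeHalves R) {a b y : R}
    (hy : y ≠ 0) (h : ∃ u v w, u * a + v * b + w * y = 1) : ∃ x, IsCoprime (a + x * b) y := by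
  obtain ⟨u, v, w, h⟩ := h
  let π := Ideal.Quotient.mk (Ideal.span {y})
  have hy0 : π y = 0 := Ideal.Quotient.eq_zero_iff_mem.2 (Ideal.mem_span_singleton_self y)
  obtain ⟨x, hx⟩ := hsr y hy (π b) (fun _ => π a) (by
    rw [Ideal.eq_top_iff_one, Set.range_const, Ideal.mem_span_singleton_sup]
    refine ⟨π v, π (u * a), ?_, ?_⟩
    · rw [Ideal.mem_span_singleton, map_mul]; exact Dvd.intro_left _ rfl
    · have := congrArg π h
      simp only [map_add, map_mul, hy0, mul_zero, add_zero, map_one] at this ⊢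
      rw [← this]; ring)
  rw [Set.range_unique, Ideal.span_singleton_eq_top] at hx
  obtain ⟨x', hx'⟩ := Ideal.Quotient.mk_surjective (x default)
  obtain ⟨z, hz⟩ := hx.exists_left_inv
  obtain ⟨z', rfl⟩ := Ideal.Quotient.mk_surjective z
  rw [← hx', ← map_mul, ← map_sub, ← map_mul, ← map_one (Ideal.Quotient.mk _),
    Ideal.Quotient.eq, Ideal.mem_span_singleton] at hz
  obtain ⟨k, hk⟩ := hz
  exact ⟨-x', z', -k, by linear_combination hk⟩

/-- `Gen(t, 1)` in elementary terms: modulo a suitable `h ∈ a + bR`, every unit is a power of one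
fixed unit times a `t`-th power. -/
theorem GenProp.exists_generator {t : ℕ} (ht : 0 < t) (hg : GenProp R t 1) {a b : R}
    (hab : IsCoprime a b) :
    ∃ h σ : R, b ∣ h - a ∧ IsCoprime σ h ∧
      ∀ u, IsCoprime u h → ∃ (k : ℕ) (v : R), IsCoprime v h ∧ h ∣ u - σ ^ k * v ^ t := by
  obtain ⟨h, hh, S, hS, hcl⟩ := hg a b
    (by rwa [← Ideal.isCoprime_iff_sup_eq, Ideal.isCoprime_span_singleton_iff])
  have hunit : ∀ u : R, IsCoprime u h → ∃ w : (R ⧸ Ideal.span {h})ˣ,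
      (w : R ⧸ Ideal.span {h}) = Ideal.Quotient.mk _ u := by
    rintro u ⟨x, y, hxy⟩
    have h1 : Ideal.Quotient.mk (Ideal.span {h}) (x * u) = 1 := by
      rw [← map_one (Ideal.Quotient.mk _), Ideal.Quotient.eq, Ideal.mem_span_singleton]
      exact ⟨-y, by linear_combination hxy⟩
    rw [map_mul] at h1
    exact ⟨Units.mkOfMulEqOne _ _ (by rw [mul_comm]; exact h1), rfl⟩
  have hlift : ∀ w : (R ⧸ Ideal.span {h})ˣ, ∃ u : R, IsCoprime u h ∧
      (w : R ⧸ Ideal.span {h}) = Ideal.Quotient.mk _ u := by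
    intro w
    obtain ⟨u, hu⟩ := Ideal.Quotient.mk_surjective (w : R ⧸ Ideal.span {h})
    obtain ⟨v, hv⟩ := Ideal.Quotient.mk_surjective ((w⁻¹ : (R ⧸ Ideal.span {h})ˣ) :
      R ⧸ Ideal.span {h})
    have h1 : Ideal.Quotient.mk (Ideal.span {h}) (v * u) = Ideal.Quotient.mk _ 1 := by
      rw [map_mul, hu, hv, map_one]; simp
    rw [Ideal.Quotient.eq, Ideal.mem_span_singleton] at h1
    obtain ⟨k, hk⟩ := h1
    exact ⟨u, ⟨v, -k, by linear_combination hk⟩, hu.symm⟩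
  obtain ⟨s, hs⟩ : ∃ s, Subgroup.closure {s | s ∈ S} ≤ Subgroup.zpowers s := by
    rcases Finset.card_le_one_iff_subset_singleton.1 hS with ⟨s, hs⟩
    refine ⟨s, (Subgroup.closure_le _).2 fun x hx => ?_⟩
    have : x = s := by simpa using hs hx
    rw [this]; exact Subgroup.mem_zpowers s
  rw [hcl] at hs
  obtain ⟨s, rfl⟩ := QuotientGroup.mk_surjective s
  obtain ⟨σ, hσ, hσs⟩ := hlift s
  refine ⟨h, σ, Ideal.mem_span_singleton.1 hh, hσ, fun u hu => ?_⟩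
  obtain ⟨w, hw⟩ := hunit u hu
  obtain ⟨k, hk⟩ := Subgroup.mem_zpowers_iff.1
    (hs (Subgroup.mem_top (QuotientGroup.mk w)))
  rw [← QuotientGroup.mk_zpow, QuotientGroup.eq] at hk
  obtain ⟨z, hz⟩ := hk
  have htz : (0 : ℤ) < t := by exact_mod_cast ht
  obtain ⟨m, hm⟩ := Int.eq_ofNat_of_zero_le (Int.emod_nonneg k htz.ne')
  have hwe : w = s ^ m * (s ^ (k / (t : ℤ)) * z) ^ t := by
    have h1 : w = s ^ k * z ^ t := by
      simp only [powMonoidHom_apply] at hz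
      rw [hz]; group
    have h2 : s ^ k = s ^ m * (s ^ (k / (t : ℤ))) ^ t := by
      rw [← zpow_natCast s m, ← hm, ← zpow_natCast (s ^ _) t, ← zpow_mul, ← zpow_add]
      congr 1
      have := Int.emod_add_mul_ediv k t
      linarith
    rw [h1, h2, mul_pow, mul_assoc]
  obtain ⟨v, hv, hvs⟩ := hlift (s ^ (k / (t : ℤ)) * z)
  refine ⟨m, v, hv, ?_⟩
  rw [← Ideal.mem_span_singleton, ← Ideal.Quotient.eq, ← hw, hwe]
  simp only [Units.val_mul, Units.val_pow_eq_pow_val, map_mul, map_pow, ← hvs, ← hσs]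

end StableRange

/-! ### Symbols -/

section Symbols

variable {R : Type*} [CommRing R]

/-- `(c, a)` is the first column, read from below, of a matrix in `SL₂(R, qR)`. -/
def IsColumn (q c a : R) : Prop := q ∣ c ∧ q ∣ a - 1 ∧ IsCoprime a c

/-- A function of first columns that is unchanged under adding multiples of `c` to `a` and
multiples of `q * a` to `c`. -/
structure IsSymbol (q : R) {Q : Type*} [CommGroup Q] (F : R → R → Q) : Prop where
  add_den : ∀ c a x, IsColumn q c a → F c (a + x * c) = F c a
  add_num : ∀ c a y, IsColumn q c a → F (c + q * y * a) a = F c a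
  zero_one : F 0 1 = 1

namespace IsColumn

variable {q c a : R}

theorem add_den (h : IsColumn q c a) (x : R) : IsColumn q c (a + x * c) := by
  obtain ⟨h1, h2, h3⟩ := h
  refine ⟨h1, ?_, h3.add_mul_right_left x⟩
  rw [show a + x * c - 1 = (a - 1) + x * c by ring]
  exact dvd_add h2 (h1.mul_left x)

theorem add_num (h : IsColumn q c a) (y : R) : IsColumn q (c + q * y * a) a := by
  obtain ⟨h1, h2, h3⟩ := h
  refine ⟨dvd_add h1 ⟨y * a, by ring⟩, h2, h3.add_mul_right_right (q * y)⟩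

theorem mul_num (h : IsColumn q c a) {c' : R} (h' : IsColumn q c' a) : IsColumn q (c * c') a :=
  ⟨h.1.mul_right c', h.2.1, h.2.2.mul_right h'.2.2⟩

theorem mul_den (h : IsColumn q c a) {a' : R} (h' : IsColumn q c a') : IsColumn q c (a * a') := by
  refine ⟨h.1, ?_, h.2.2.mul_left h'.2.2⟩
  rw [show a * a' - 1 = (a - 1) * a' + (a' - 1) by ring]
  exact dvd_add (h.2.1.mul_right _) h'.2.1

theorem of_isCoprime (ha : q ∣ a - 1) {u : R} (hu : IsCoprime u a) : IsColumn q (q * u) a := by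
  obtain ⟨k, hk⟩ := ha
  exact ⟨dvd_mul_right q u, ⟨k, hk⟩,
    IsCoprime.mul_right ⟨1, -k, by linear_combination hk⟩ hu.symm⟩

end IsColumn

namespace IsSymbol

variable {q : R} {Q : Type*} [CommGroup Q] {F : R → R → Q}

theorem eq_one_of_dvd (hF : IsSymbol q F) {c a : R} (hc : q ∣ c) (ha : c ∣ a - 1) :
    F c a = 1 := by
  obtain ⟨k, hk⟩ := ha
  obtain ⟨y, rfl⟩ := hc
  have h1 : a = 1 + k * (q * y) := by linear_combination hk
  have h2 : IsColumn q (q * y) 1 := ⟨dvd_mul_right _ _, by simp, isCoprime_one_left⟩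
  have h3 : IsColumn q 0 (1 : R) := ⟨dvd_zero _, by simp, isCoprime_one_left⟩
  rw [h1, hF.add_den _ _ _ h2, ← hF.zero_one, ← hF.add_num 0 1 y h3]
  congr 1; ring

theorem eq_one_of_isUnit (hF : IsSymbol q F) {c a : R} (hc : q ∣ c) (ha : q ∣ a - 1)
    (hu : IsUnit a) : F c a = 1 := by
  obtain ⟨v, hv⟩ := hu.exists_left_inv
  obtain ⟨y, rfl⟩ := hc
  have h1 : IsColumn q (q * y) a := ⟨dvd_mul_right _ _, ha, v, 0, by linear_combination hv⟩
  rw [← hF.add_num _ _ ((1 - y) * v) h1,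
    show q * y + q * ((1 - y) * v) * a = q by linear_combination q * (1 - y) * hv]
  exact hF.eq_one_of_dvd dvd_rfl ha

theorem congr_den (hF : IsSymbol q F) {c a a' : R} (h : IsColumn q c a) (ha : c ∣ a' - a) :
    F c a' = F c a := by
  obtain ⟨x, hx⟩ := ha
  rw [← hF.add_den c a x h]; congr 1; linear_combination hx

/-- With stable range at most `3/2`, two symbols can be given a common denominator: when the
numerators are `q * γ₁` and `q * γ₂` with `γ₁`, `γ₂` coprime, the denominators agree after adding
multiples of the numerators, because they are congruent modulo `q`. -/
theorem exists_common_den (hF : IsSymbol q F) (hsr : StableRangeLEThreeHalves R)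
    {c₁ a₁ c₂ a₂ : R} (h₁ : IsColumn q c₁ a₁) (h₂ : IsColumn q c₂ a₂) :
    ∃ c₁' c₂' a, IsColumn q c₁' a ∧ IsColumn q c₂' a ∧
      F c₁' a = F c₁ a₁ ∧ F c₂' a = F c₂ a₂ := by
  rcases subsingleton_or_nontrivial R with hR | hR
  · refine ⟨c₁, c₂, a₁, h₁, ?_, rfl, ?_⟩ <;> rw [Subsingleton.elim a₁ a₂]
    exact h₂
  -- the numerator over `a₂` may be taken to be `q` times a non-zero element
  obtain ⟨γ₂, hγ0, hcol₂, hF₂⟩ : ∃ γ₂, γ₂ ≠ 0 ∧ IsColumn q (q * γ₂) a₂ ∧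
      F (q * γ₂) a₂ = F c₂ a₂ := by
    obtain ⟨γ, rfl⟩ := h₂.1
    by_cases hγ : γ = 0
    · refine ⟨γ + a₂, ?_, ?_, ?_⟩
      · intro h
        have h0 : a₂ = 0 := by simpa [hγ] using h
        have h3 := h₂.2.2
        rw [h0, hγ, mul_zero, isCoprime_zero_left] at h3
        exact not_isUnit_zero h3
      · have := h₂.add_num 1
        rwa [show q * γ + q * 1 * a₂ = q * (γ + a₂) by ring] at this
      · rw [← hF.add_num _ _ 1 h₂]; congr 1; ring
    · exact ⟨γ, hγ, h₂, rfl⟩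
  obtain ⟨γ₁, rfl⟩ := h₁.1
  obtain ⟨u, v, huv⟩ := h₁.2.2
  obtain ⟨z, m, n, hz⟩ := hsr.exists_isCoprime (a := γ₁) (b := a₁) hγ0
    ⟨v * q, u, 0, by linear_combination huv⟩
  obtain ⟨k₁, hk₁⟩ := h₁.2.1
  obtain ⟨k₂, hk₂⟩ := hcol₂.2.1
  have hcol₁ := h₁.add_num z
  have hF₁ := hF.add_num _ _ z h₁
  rw [show q * γ₁ + q * z * a₁ = q * (γ₁ + z * a₁) by ring] at hcol₁ hF₁
  have e : a₁ + (k₂ - k₁) * m * (q * (γ₁ + z * a₁)) = a₂ + (k₁ - k₂) * n * (q * γ₂) := by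
    linear_combination hk₁ - hk₂ + q * (k₂ - k₁) * hz
  refine ⟨q * (γ₁ + z * a₁), q * γ₂, a₁ + (k₂ - k₁) * m * (q * (γ₁ + z * a₁)),
    hcol₁.add_den _, ?_, ?_, ?_⟩
  · rw [e]; exact hcol₂.add_den _
  · rw [hF.add_den _ _ _ hcol₁, hF₁]
  · rw [e, hF.add_den _ _ _ hcol₂, hF₂]

end IsSymbol

/-- A symbol that is multiplicative in its numerator. -/
structure IsMulSymbol (q : R) {Q : Type*} [CommGroup Q] (F : R → R → Q) : Prop
    extends IsSymbol q F where
  mul_num : ∀ c c' a, IsColumn q c a → IsColumn q c' a → F (c * c') a = F c a * F c' a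

namespace IsMulSymbol

variable {q : R} {Q : Type*} [CommGroup Q] {F : R → R → Q}

theorem self_mul (hF : IsMulSymbol q F) {c a : R} (h : IsColumn q c a) :
    F (q * c) a = F c a := by
  have hq : IsColumn q q a := by
    simpa using IsColumn.of_isCoprime h.2.1 (isCoprime_one_left (x := a))
  rw [hF.mul_num _ _ _ hq h, hF.eq_one_of_dvd dvd_rfl h.2.1, one_mul]

/-- For `a ≡ 1` modulo `q`, the map `u ↦ F (q * u) a` is multiplicative on all elements prime
to `a`, multiples of `q` or not. -/
theorem bracket_mul (hF : IsMulSymbol q F) {a u v : R} (ha : q ∣ a - 1) (hu : IsCoprime u a)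
    (hv : IsCoprime v a) : F (q * (u * v)) a = F (q * u) a * F (q * v) a := by
  rw [← hF.mul_num _ _ _ (.of_isCoprime ha hu) (.of_isCoprime ha hv),
    ← hF.self_mul (.of_isCoprime ha (hu.mul_left hv))]
  congr 1; ring

theorem bracket_congr (hF : IsSymbol q F) {a u v : R} (ha : q ∣ a - 1) (hu : IsCoprime u a)
    (huv : a ∣ v - u) : F (q * v) a = F (q * u) a := by
  obtain ⟨z, hz⟩ := huv
  rw [← hF.add_num _ _ z (.of_isCoprime ha hu)]
  congr 1; linear_combination q * hz

theorem bracket_pow (hF : IsMulSymbol q F) {a u : R} (ha : q ∣ a - 1) (hu : IsCoprime u a)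
    (n : ℕ) : F (q * u ^ n) a = F (q * u) a ^ n := by
  induction n with
  | zero => simpa using hF.eq_one_of_dvd dvd_rfl ha
  | succ n ih => rw [pow_succ, pow_succ, hF.bracket_mul ha hu.pow_left hu, ih]

theorem bracket_neg_one (hF : IsSymbol q F) {a : R} (ha : q ∣ a - 1) : F (q * (-1)) a = 1 :=
  hF.eq_one_of_dvd (dvd_mul_right _ _) (by simpa using ha)

theorem exists_inv (hF : IsMulSymbol q F) {c a : R} (h : IsColumn q c a) :
    ∃ c', IsColumn q c' a ∧ F c' a = (F c a)⁻¹ := by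
  obtain ⟨v, u, huv⟩ := h.2.2
  have hu : IsCoprime u a := ⟨c, v, by linear_combination huv⟩
  refine ⟨q * u, .of_isCoprime h.2.1 hu, ?_⟩
  rw [eq_inv_iff_mul_eq_one, ← hF.mul_num _ _ _ (.of_isCoprime h.2.1 hu) h, mul_assoc,
    bracket_congr hF.toIsSymbol h.2.1 (isCoprime_one_left) (v := u * c)
      ⟨-v, by linear_combination huv⟩, mul_one]
  exact hF.eq_one_of_dvd dvd_rfl h.2.1

end IsMulSymbol

end Symbols

/-! ### Pairs of a long and a short symbol -/

section SymbolPairs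

variable {R : Type*} [CommRing R]

theorem mem_congruenceSL2_iff {I : Ideal R} {A : SL(2, R)} :
    A ∈ congruenceSL2 I ↔ A 0 0 - 1 ∈ I ∧ A 0 1 ∈ I ∧ A 1 0 ∈ I ∧ A 1 1 - 1 ∈ I := by
  rw [congruenceSL2, MonoidHom.mem_ker, Matrix.SpecialLinearGroup.ext_iff]
  simp only [Fin.forall_fin_two, Matrix.SpecialLinearGroup.map_apply_coe,
    RingHom.mapMatrix_apply, Matrix.map_apply, Matrix.SpecialLinearGroup.coe_one,
    Matrix.one_apply_eq, ne_eq, zero_ne_one, one_ne_zero, not_false_eq_true,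
    Matrix.one_apply_ne, Ideal.Quotient.eq_zero_iff_mem, and_assoc]
  rw [← map_one (Ideal.Quotient.mk I), Ideal.Quotient.eq, Ideal.Quotient.eq]

/-- The matrix of determinant one with the given entries. -/
def mkSL2 (a b c d : R) (h : a * d - b * c = 1) : SL(2, R) :=
  ⟨!![a, b; c, d], by rw [Matrix.det_fin_two_of, h]⟩

theorem mkSL2_val (a b c d : R) (h : a * d - b * c = 1) :
    (mkSL2 a b c d h : Matrix (Fin 2) (Fin 2) R) = !![a, b; c, d] := rfl

theorem exists_mem_congruenceSL2 {I : Ideal R} {a c : R} (hc : c ∈ I) (ha : a - 1 ∈ I)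
    (h : IsCoprime a c) : ∃ A ∈ congruenceSL2 I, A 0 0 = a ∧ A 1 0 = c := by
  obtain ⟨u, v, huv⟩ := h
  have hdet : a * (1 - (a - 1) * u) - (a - 1) * v * c = 1 := by linear_combination (1 - a) * huv
  refine ⟨mkSL2 _ _ _ _ hdet, ?_, rfl, rfl⟩
  · rw [mem_congruenceSL2_iff]
    refine ⟨ha, I.mul_mem_right _ ha, hc, ?_⟩
    change 1 - (a - 1) * u - 1 ∈ I
    rw [show 1 - (a - 1) * u - 1 = (a - 1) * (-u) by ring]
    exact I.mul_mem_right _ ha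

theorem det_SL2 (A : SL(2, R)) : A 0 0 * A 1 1 - A 0 1 * A 1 0 = 1 := by
  rw [← Matrix.det_fin_two]; exact A.2

theorem isColumn_of_mem {q : R} {A : SL(2, R)} (hA : A ∈ congruenceSL2 (Ideal.span {q})) :
    IsColumn q (A 1 0) (A 0 0) := by
  simp only [mem_congruenceSL2_iff, Ideal.mem_span_singleton] at hA
  exact ⟨hA.2.2.1, hA.1, A 1 1, -A 0 1, by linear_combination det_SL2 A⟩

theorem IsColumn.exists_matrix {q c a : R} (h : IsColumn q c a) :
    ∃ A ∈ congruenceSL2 (Ideal.span {q}), A 0 0 = a ∧ A 1 0 = c :=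
  exists_mem_congruenceSL2 (Ideal.mem_span_singleton.2 h.1) (Ideal.mem_span_singleton.2 h.2.1)
    h.2.2

/-- The relations satisfied by the symbols of the long and short root subgroups `SL₂(R, qR)` of
`Sp₄(R)` with values in `C(C₂, R, qR) / E(C₂, R, qR)`. -/
structure IsSymbolPair (q : R) {Q : Type*} [CommGroup Q] (L S : R → R → Q) : Prop where
  long : IsSymbol q L
  short : IsSymbol q S
  sq_mul : ∀ c c' a, IsColumn q c a → IsColumn q c' a → S c a * L c' a = L (c ^ 2 * c') a
  surj : ∀ z, ∃ c a, IsColumn q c a ∧ L c a = z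
  mul : ∀ A ∈ congruenceSL2 (Ideal.span {q}), ∀ B ∈ congruenceSL2 (Ideal.span {q}),
    S ((A * B) 1 0) ((A * B) 0 0) = S (A 1 0) (A 0 0) * S (B 1 0) (B 0 0)
  row : ∀ A ∈ congruenceSL2 (Ideal.span {q}), ∀ B ∈ congruenceSL2 (Ideal.span {q}),
    A 0 1 = B 0 1 → A 0 1 ∣ B 0 0 - A 0 0 → S (A 1 0) (A 0 0) = S (B 1 0) (B 0 0)

namespace IsSymbolPair

variable {q : R} {Q : Type*} [CommGroup Q] {L S : R → R → Q}

theorem isMulSymbol (h : IsSymbolPair q L S) : IsMulSymbol q S where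
  toIsSymbol := h.short
  mul_num c c' a hc hc' := by
    have h1 := h.sq_mul (c * c') c a (hc.mul_num hc') hc
    have h2 := h.sq_mul c' c a hc' hc
    have hc2 : IsColumn q (c' ^ 2 * c) a := by
      rw [pow_two]; exact (hc'.mul_num hc').mul_num hc
    have h3 := h.sq_mul c (c' ^ 2 * c) a hc hc2
    rw [← h2, show c ^ 2 * (c' ^ 2 * c) = (c * c') ^ 2 * c by ring, ← h1, ← mul_assoc] at h3
    exact (mul_right_cancel h3).symm

/-- Multiplicativity of the short symbol in its denominator. The product of matrices with first
columns `(a, c)` and `(a', c)` has first column `(x, c * e)` with `x = a * e - 1` congruent to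
`a * a'` modulo `c`, and the symbol of `q * e` over `x` is trivial. -/
theorem short_mul_den (h : IsSymbolPair q L S) {c a a' : R} (hc : IsColumn q c a)
    (hc' : IsColumn q c a') : S c (a * a') = S c a * S c a' := by
  have hS := h.isMulSymbol
  obtain ⟨A, hA, hA1, hA2⟩ := hc.exists_matrix
  obtain ⟨B, hB, hB1, hB2⟩ := hc'.exists_matrix
  have hAB := h.mul A hA B hB
  have hcol := isColumn_of_mem (mul_mem hA hB)
  have hdet := det_SL2 A
  simp only [Matrix.SpecialLinearGroup.coe_mul, Matrix.mul_apply, Fin.sum_univ_two, hA1, hA2,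
    hB1, hB2] at hAB hcol hdet
  have hd := ((mem_congruenceSL2_iff.1 hA).2.2.2)
  rw [Ideal.mem_span_singleton] at hd
  set d := A 1 1
  set b := A 0 1
  obtain ⟨kd, hkd⟩ := hd
  obtain ⟨ka, hka⟩ := hc.2.1
  obtain ⟨ka', hka'⟩ := hc'.2.1
  have hx : a * a' + b * c = a * (a' + d) - 1 := by linear_combination -hdet
  have hn : c * a' + d * c = c * (a' + d) := by ring
  rw [hx, hn] at hAB hcol
  have hqx := hcol.2.1
  have hcx : IsCoprime c (a * (a' + d) - 1) := (hcol.2.2.of_mul_right_left).symm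
  have hex : IsCoprime (a' + d) (a * (a' + d) - 1) := ⟨a, -1, by ring⟩
  have hq1 : q ∣ a' + d - 1 - 1 := ⟨ka' + kd, by linear_combination hka' + hkd⟩
  have he1 : IsCoprime (a' + d) (a' + d - 1) := ⟨1, -1, by ring⟩
  have htriv : S (q * (a' + d)) (a * (a' + d) - 1) = 1 := by
    rw [hS.congr_den (.of_isCoprime hq1 he1) ⟨ka, by linear_combination (a' + d) * hka⟩,
      IsMulSymbol.bracket_congr h.short hq1 (isCoprime_one_left (x := a' + d - 1)) ⟨1, by ring⟩,
      mul_one]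
    exact h.short.eq_one_of_dvd dvd_rfl hq1
  have hcc : IsColumn q c (a * (a' + d) - 1) := ⟨hc.1, hqx, hcx.symm⟩
  rw [← hS.self_mul hcol, hS.bracket_mul hqx hcx hex, htriv, mul_one, hS.self_mul hcc] at hAB
  rw [← hAB]
  exact h.short.congr_den hcc ⟨-b, by linear_combination hx⟩

theorem short_pow_den (h : IsSymbolPair q L S) {c a : R} (hc : IsColumn q c a) (n : ℕ) :
    IsColumn q c (a ^ n) ∧ S c (a ^ n) = S c a ^ n := by
  induction n with
  | zero =>
    have h1 : IsColumn q c (1 : R) := ⟨hc.1, by simp, isCoprime_one_left⟩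
    simpa using ⟨h1, h.short.eq_one_of_isUnit hc.1 (by simp) isUnit_one⟩
  | succ n ih =>
    rw [pow_succ, pow_succ]
    exact ⟨ih.1.mul_den hc, by rw [h.short_mul_den ih.1 hc, ih.2]⟩

theorem short_prod_den (h : IsSymbolPair q L S) {ι : Type*} (s : Finset ι) {c : R} (x : ι → R)
    (hq : q ∣ c) (hc : ∀ i, IsColumn q c (x i)) :
    IsColumn q c (∏ i ∈ s, x i) ∧ S c (∏ i ∈ s, x i) = ∏ i ∈ s, S c (x i) := by
  classical
  induction s using Finset.induction_on with
  | empty =>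
    have h1 : IsColumn q c (1 : R) := ⟨hq, by simp, isCoprime_one_left⟩
    simpa using ⟨h1, h.short.eq_one_of_isUnit hq (by simp) isUnit_one⟩
  | insert i s hi ih =>
    rw [Finset.prod_insert hi, Finset.prod_insert hi]
    exact ⟨(hc i).mul_den ih.1, by rw [h.short_mul_den (hc i) ih.1, ih.2]⟩

/-- For commuting `A` and `X = f + g A` in `SL₂(R, qR)`, with `A` having first row `(a, b)` and
first column `(a, c)`, the symbol of `c` over the corner `x = f + g a` of `X` has order dividing
two if `x` is congruent to a unit modulo `b`.

Writing `⟨u⟩` for the symbol of `q u`, the determinant of `X` gives `⟨b⟩⟨c⟩⟨g⟩² = 1` over `x`, where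
`⟨b⟩ = 1`. As `q g` divides `x - (f + g)`, the symbol `⟨g⟩` can be computed over `f + g`, where the
trace `2 + q² s` of `A` gives `⟨g⟩²⟨s⟩ = 1`, and `⟨s⟩² = 1` because `q s` divides
`(f + g)² - 1`. -/
theorem short_sq_eq_one (h : IsSymbolPair q L S) {a b c d f g u : R}
    (ha : q ∣ a - 1) (hb : q ∣ b) (hc : q ∣ c) (hd : q ∣ d - 1) (hA : a * d - b * c = 1)
    (hX : (f + g * a) * (f + g * d) - g ^ 2 * (b * c) = 1) (hx : q ∣ f + g * a - 1)
    (hu : IsUnit u) (hbu : b ∣ f + g * a - u) :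
    IsColumn q c (f + g * a) ∧ S c (f + g * a) ^ 2 = 1 := by
  have hS := h.isMulSymbol
  set x := f + g * a with hxdef
  set y := f + g * d
  have cb : IsCoprime b x := ⟨-(g ^ 2 * c), y, by linear_combination hX⟩
  have cc : IsCoprime c x := ⟨-(g ^ 2 * b), y, by linear_combination hX⟩
  have cg : IsCoprime g x := ⟨-(g * b * c), y, by linear_combination hX⟩
  have hcol : IsColumn q c x := ⟨hc, hx, cc.symm⟩
  have hcolb : IsColumn q b x := ⟨hb, hx, cb.symm⟩
  refine ⟨hcol, ?_⟩
  have hb1 : S b x = 1 := by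
    have hqu : q ∣ u - 1 := by
      have := dvd_sub hx (hb.trans hbu)
      rwa [show x - 1 - (x - u) = u - 1 by ring] at this
    obtain ⟨v, hv⟩ := hu.exists_left_inv
    have hcolu : IsColumn q b u := ⟨hb, hqu, v, 0, by linear_combination hv⟩
    rw [h.short.congr_den hcolu hbu]
    exact h.short.eq_one_of_isUnit hb hqu hu
  have hrel : S (q * b) x * S (q * c) x * S (q * g) x ^ 2 = 1 := by
    rw [← hS.bracket_mul hx cb cc, ← hS.bracket_pow hx cg,
      ← hS.bracket_mul hx (cb.mul_left cc) cg.pow_left,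
      IsMulSymbol.bracket_congr h.short hx (isCoprime_one_left.neg_left) (u := -1)
        ⟨y, by linear_combination -hX⟩]
    exact IsMulSymbol.bracket_neg_one h.short hx
  rw [hS.self_mul hcol, hS.self_mul hcolb, hb1, one_mul] at hrel
  -- the denominator `x` is now replaced by `x' = f + g`
  obtain ⟨α, hα⟩ := ha
  obtain ⟨β, rfl⟩ := hb
  obtain ⟨γ, rfl⟩ := hc
  obtain ⟨δ, hδ⟩ := hd
  obtain ⟨ξ, hξ⟩ := hx
  obtain rfl : a = 1 + q * α := by linear_combination hα
  obtain rfl : d = 1 + q * δ := by linear_combination hδ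
  have hx' : q ∣ f + g - 1 := ⟨ξ - g * α, by linear_combination hξ - hxdef⟩
  have hgx : S (q * g) x = S (q * g) (f + g) := by
    have hgc : IsCoprime g (f + g) := by
      have := cg.add_mul_left_right (-(q * α))
      rwa [show x + g * -(q * α) = f + g by rw [hxdef]; ring] at this
    exact h.short.congr_den (.of_isCoprime hx' hgc) ⟨α, by rw [hxdef]; ring⟩
  set s := β * γ - α * δ with hs
  have htr : q * α + q * δ = q ^ 2 * s := by rw [hs]; linear_combination hA
  have hsq : (f + g) ^ 2 = 1 - f * g * (q ^ 2 * s) := by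
    rw [← htr]; linear_combination hX - g ^ 2 * hA
  have cg' : IsCoprime g (f + g) :=
    ⟨f * q ^ 2 * s, f + g, by linear_combination hsq⟩
  have cs' : IsCoprime s (f + g) :=
    ⟨f * g * q ^ 2, f + g, by linear_combination hsq⟩
  have cq' : IsCoprime q (f + g) :=
    ⟨f * g * q * s, f + g, by linear_combination hsq⟩
  have hs2 : S (q * s) (f + g) ^ 2 = 1 := by
    have hcs := IsColumn.of_isCoprime hx' cs'
    rw [← (h.short_pow_den hcs 2).2]
    exact h.short.eq_one_of_dvd (dvd_mul_right _ _) ⟨-(f * g * q), by linear_combination hsq⟩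
  have hq1 : S (q * q) (f + g) = 1 := by
    have : IsColumn q q (f + g) := ⟨dvd_rfl, hx', cq'.symm⟩
    rw [hS.self_mul this]
    exact h.short.eq_one_of_dvd dvd_rfl hx'
  have hrel' : S (q * g) (f + g) ^ 2 * S (q * s) (f + g) = 1 := by
    have h1 : S (q * (g ^ 2 * q ^ 2 * s)) (f + g) = 1 := by
      rw [IsMulSymbol.bracket_congr h.short hx' (isCoprime_one_left.neg_left) (u := -1)
        ⟨f + g + g * q ^ 2 * s, by linear_combination -hsq⟩]
      exact IsMulSymbol.bracket_neg_one h.short hx'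
    rwa [hS.bracket_mul hx' (cg'.pow_left.mul_left cq'.pow_left) cs',
      hS.bracket_mul hx' cg'.pow_left cq'.pow_left, hS.bracket_pow hx' cg',
      hS.bracket_pow hx' cq', hq1, one_pow, mul_one] at h1
  have hg4 : (S (q * g) (f + g) ^ 2) ^ 2 = 1 := by
    rw [eq_inv_of_mul_eq_one_left hrel', inv_pow, hs2, inv_one]
  rw [eq_inv_of_mul_eq_one_left hrel, inv_pow, hgx, hg4, inv_one]

/-- The short symbol has exponent `t` by `Exp(t, l)`. -/
theorem short_pow_eq_one (h : IsSymbolPair q L S) (hq : q ≠ 0) {t l : ℕ} (hexp : ExpProp R t l)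
    {c a : R} (hc : IsColumn q c a) : S c a ^ t = 1 := by
  have hS := h.isMulSymbol
  obtain ⟨A, hA, rfl, rfl⟩ := hc.exists_matrix
  have hA' := mem_congruenceSL2_iff.1 hA
  obtain ⟨a', c', d', u, f, g, b, d, ha', ⟨B, hB, hBM⟩, hM, hX, hprod, hu⟩ :=
    hexp q hq (A 0 1) (A 0 0) ⟨hA'.2.1, hA'.1, by
      rw [← Ideal.isCoprime_iff_sup_eq, Ideal.isCoprime_span_singleton_iff]
      exact ⟨A 1 1, -A 1 0, by linear_combination det_SL2 A⟩⟩
  have hB00 : B 0 0 = a' := congrFun₂ hBM 0 0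
  have hB01 : B 0 1 = A 0 1 := congrFun₂ hBM 0 1
  have hB10 : B 1 0 = c' := congrFun₂ hBM 1 0
  rw [Ideal.mem_span_singleton] at ha' hprod
  have hcol := isColumn_of_mem hB
  rw [h.row A hA B hB hB01.symm (by rwa [hB00])]
  rw [hB00, hB10] at hcol ⊢
  have hx : ∀ i, IsColumn q c' (f i + g i * a') ∧ S c' (f i + g i * a') ^ 2 = 1 := by
    intro i
    obtain ⟨M, hM, hMe⟩ := hM i
    obtain ⟨X, hX, hXe⟩ := hX i
    have hM' := mem_congruenceSL2_iff.1 hM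
    have hX' := mem_congruenceSL2_iff.1 hX
    have hMd := det_SL2 M
    have hXd := det_SL2 X
    simp only [hMe, hXe, Ideal.mem_span_singleton] at hM' hX' hMd hXd
    simp at hM' hX' hMd hXd
    exact h.short_sq_eq_one hM'.1 hM'.2.1 hM'.2.2.1 hM'.2.2.2 hMd
      (by linear_combination hXd) hX'.1 (hu i).1 (Ideal.mem_span_singleton.1 (hu i).2)
  have hx2 : ∀ i, IsColumn q c' ((f i + g i * a') ^ 2) ∧ S c' ((f i + g i * a') ^ 2) = 1 :=
    fun i => ⟨(h.short_pow_den (hx i).1 2).1, by rw [(h.short_pow_den (hx i).1 2).2, (hx i).2]⟩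
  have hpr := h.short_prod_den Finset.univ _ hcol.1 fun i => (hx2 i).1
  rw [← (h.short_pow_den hcol t).2, ← h.short.congr_den (h.short_pow_den hcol t).1 hprod, hpr.2]
  exact Finset.prod_eq_one fun i _ => (hx2 i).2

/-- The subgroup of all values of the short symbol. -/
def shortSubgroup (h : IsSymbolPair q L S) (hsr : StableRangeLEThreeHalves R) : Subgroup Q where
  carrier := {z | ∃ c a, IsColumn q c a ∧ S c a = z}
  one_mem' := ⟨0, 1, ⟨dvd_zero _, by simp, isCoprime_one_left⟩, h.short.zero_one⟩
  mul_mem' := by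
    rintro _ _ ⟨c₁, a₁, h₁, rfl⟩ ⟨c₂, a₂, h₂, rfl⟩
    obtain ⟨c₁', c₂', a, h₁', h₂', e₁, e₂⟩ := h.short.exists_common_den hsr h₁ h₂
    exact ⟨c₁' * c₂', a, h₁'.mul_num h₂', by rw [h.isMulSymbol.mul_num _ _ _ h₁' h₂', e₁, e₂]⟩
  inv_mem' := by
    rintro _ ⟨c, a, hc, rfl⟩
    obtain ⟨c', hc', e⟩ := h.isMulSymbol.exists_inv hc
    exact ⟨c', a, hc', e⟩

/-- Two symbols with a common denominator, after changing the denominator within its class modulo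
the product of the numerators, become `q γ₁` and `q γ₂` over `m` such that the units modulo `m`
are, up to `t`-th powers, powers of one unit. -/
theorem exists_gen_den {F : R → R → Q} (hF : IsSymbol q F) {t : ℕ} (ht : 0 < t)
    (hg : GenProp R t 1) {c₁ c₂ a : R} (h₁ : IsColumn q c₁ a) (h₂ : IsColumn q c₂ a) :
    ∃ m σ γ₁ γ₂, q ∣ m - 1 ∧ IsCoprime σ m ∧ IsCoprime γ₁ m ∧ IsCoprime γ₂ m ∧
      F c₁ a = F (q * γ₁) m ∧ F c₂ a = F (q * γ₂) m ∧
      ∀ u, IsCoprime u m → ∃ (k : ℕ) (v : R), IsCoprime v m ∧ m ∣ u - σ ^ k * v ^ t := by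
  obtain ⟨m, σ, hm, hσ, hgen⟩ := hg.exists_generator ht (h₁.2.2.mul_right h₂.2.2)
  obtain ⟨k, hk⟩ := hm
  have e₁ : m = a + k * c₂ * c₁ := by linear_combination hk
  have e₂ : m = a + k * c₁ * c₂ := by linear_combination hk
  have h₁' := h₁.add_den (k * c₂)
  have h₂' := h₂.add_den (k * c₁)
  rw [← e₁] at h₁'
  rw [← e₂] at h₂'
  have f₁ := hF.add_den _ _ (k * c₂) h₁
  have f₂ := hF.add_den _ _ (k * c₁) h₂
  rw [← e₁] at f₁
  rw [← e₂] at f₂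
  obtain ⟨γ₁, rfl⟩ := h₁.1
  obtain ⟨γ₂, rfl⟩ := h₂.1
  exact ⟨m, σ, γ₁, γ₂, h₁'.2.1, hσ, h₁'.2.2.of_mul_right_right.symm,
    h₂'.2.2.of_mul_right_right.symm, f₁.symm, f₂.symm, hgen⟩

theorem card_shortSubgroup_le (h : IsSymbolPair q L S) (hq : q ≠ 0)
    (hsr : StableRangeLEThreeHalves R) {t l : ℕ} (ht : 0 < t) (hgen : GenProp R t 1)
    (hexp : ExpProp R t l) :
    Finite (h.shortSubgroup hsr) ∧ Nat.card (h.shortSubgroup hsr) ≤ t := by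
  have hS := h.isMulSymbol
  refine card_le_of_locally_cyclic ht ?_ ?_
  · rintro ⟨_, c, a, hc, rfl⟩
    exact Subtype.ext (h.short_pow_eq_one hq hexp hc)
  · rintro ⟨_, c₁, a₁, h₁, rfl⟩ ⟨_, c₂, a₂, h₂, rfl⟩
    obtain ⟨c₁', c₂', a, h₁', h₂', e₁, e₂⟩ := h.short.exists_common_den hsr h₁ h₂
    obtain ⟨m, σ, γ₁, γ₂, hm, hσ, hγ₁, hγ₂, f₁, f₂, hu⟩ :=
      exists_gen_den h.short ht hgen h₁' h₂'
    have key : ∀ γ, IsCoprime γ m → ∃ k : ℕ, S (q * γ) m = S (q * σ) m ^ k := by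
      intro γ hγ
      obtain ⟨k, v, hv, hdvd⟩ := hu γ hγ
      refine ⟨k, ?_⟩
      rw [IsMulSymbol.bracket_congr h.short hm (hσ.pow_left.mul_left hv.pow_left) hdvd,
        hS.bracket_mul hm hσ.pow_left hv.pow_left, hS.bracket_pow hm hσ, hS.bracket_pow hm hv,
        h.short_pow_eq_one hq hexp (.of_isCoprime hm hv), mul_one]
    obtain ⟨k₁, hk₁⟩ := key γ₁ hγ₁
    obtain ⟨k₂, hk₂⟩ := key γ₂ hγ₂
    refine ⟨⟨S (q * σ) m, _, _, .of_isCoprime hm hσ, rfl⟩, ⟨k₁, Subtype.ext ?_⟩,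
      ⟨k₂, Subtype.ext ?_⟩⟩
    · simp [← hk₁, ← f₁, e₁]
    · simp [← hk₂, ← f₂, e₂]

/-- By `Gen(2, 1)`, the values of the short symbol have index at most two, because modulo them the
long symbol is unchanged when its numerator is multiplied by a square. -/
theorem index_shortSubgroup_le (h : IsSymbolPair q L S) (hsr : StableRangeLEThreeHalves R)
    (hgen : GenProp R 2 1) :
    (h.shortSubgroup hsr).index ≠ 0 ∧ (h.shortSubgroup hsr).index ≤ 2 := by
  refine index_le_two_of_forall_inv_mul_mem _ fun z₁ z₂ hz₁ hz₂ => ?_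
  obtain ⟨c₁, a₁, h₁, rfl⟩ := h.surj z₁
  obtain ⟨c₂, a₂, h₂, rfl⟩ := h.surj z₂
  obtain ⟨c₁', c₂', a, h₁', h₂', e₁, e₂⟩ := h.long.exists_common_den hsr h₁ h₂
  obtain ⟨m, σ, γ₁, γ₂, hm, hσ, hγ₁, hγ₂, f₁, f₂, hu⟩ :=
    exists_gen_den h.long two_pos hgen h₁' h₂'
  have hqm : IsColumn q q m := by
    simpa using IsColumn.of_isCoprime hm (isCoprime_one_left (x := m))
  -- `[q u v² / m] = {q v / m} [q u / m]`, by comparing both sides with `[q³ u v² / m]`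
  have hsq : ∀ u v, IsCoprime u m → IsCoprime v m →
      L (q * (u * v ^ 2)) m = S (q * v) m * L (q * u) m := by
    intro u v hu hv
    have k1 := h.sq_mul _ _ _ (IsColumn.of_isCoprime hm hv) (IsColumn.of_isCoprime hm hu)
    have k2 := h.sq_mul q _ _ hqm (IsColumn.of_isCoprime hm (hu.mul_left (hv.pow_left (m := 2))))
    rw [h.short.eq_one_of_dvd dvd_rfl hm, one_mul] at k2
    rw [k1, k2]; congr 1; ring
  have key : ∀ γ, IsCoprime γ m → L (q * γ) m ∉ h.shortSubgroup hsr →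
      (L (q * σ) m)⁻¹ * L (q * γ) m ∈ h.shortSubgroup hsr := by
    intro γ hγ hnot
    obtain ⟨k, v, hv, hdvd⟩ := hu γ hγ
    have hw : IsCoprime (σ ^ (k / 2) * v) m := hσ.pow_left.mul_left hv
    have hmem : S (q * (σ ^ (k / 2) * v)) m ∈ h.shortSubgroup hsr :=
      ⟨_, _, .of_isCoprime hm hw, rfl⟩
    rw [IsMulSymbol.bracket_congr h.long hm (hσ.pow_left.mul_left hv.pow_left) hdvd] at hnot ⊢
    rcases Nat.even_or_odd' k with ⟨j, rfl | rfl⟩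
    · rw [show 2 * j / 2 = j by omega] at hw hmem
      refine absurd ?_ hnot
      rw [show σ ^ (2 * j) * v ^ 2 = 1 * (σ ^ j * v) ^ 2 by ring,
        hsq _ _ isCoprime_one_left hw, mul_one, h.long.eq_one_of_dvd dvd_rfl hm, mul_one]
      exact hmem
    · rw [show (2 * j + 1) / 2 = j by omega] at hw hmem
      rw [show σ ^ (2 * j + 1) * v ^ 2 = σ * (σ ^ j * v) ^ 2 by ring, hsq _ _ hσ hw,
        mul_comm (S _ _), inv_mul_cancel_left]
      exact hmem
  rw [← e₁, f₁] at hz₁ ⊢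
  rw [← e₂, f₂] at hz₂ ⊢
  have := mul_mem (inv_mem (key γ₁ hγ₁ hz₁)) (key γ₂ hγ₂ hz₂)
  simpa [mul_assoc] using this

theorem card_le (h : IsSymbolPair q L S) (hq : q ≠ 0) (hsr : StableRangeLEThreeHalves R)
    {t l : ℕ} (ht : 0 < t) (hgen2 : GenProp R 2 1) (hgen : GenProp R t 1)
    (hexp : ExpProp R t l) : Finite Q ∧ Nat.card Q ≤ 2 * t := by
  obtain ⟨hfin, hcard⟩ := h.card_shortSubgroup_le hq hsr ht hgen hexp
  obtain ⟨hi0, hi⟩ := h.index_shortSubgroup_le hsr hgen2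
  have hmul := (h.shortSubgroup hsr).card_mul_index
  have h0 : Nat.card Q ≠ 0 := by
    rw [← hmul]; exact mul_ne_zero Nat.card_pos.ne' hi0
  refine ⟨Nat.finite_of_card_ne_zero h0, ?_⟩
  rw [← hmul, mul_comm]
  exact Nat.mul_le_mul hi hcard

end IsSymbolPair

end SymbolPairs

/-! ### Embeddings of `SL₂` into `Sp₄` and their conjugation action -/

section Embeddings

variable {R : Type*} [CommRing R]

theorem Sp4.ext_entries {g g' : Sp4 R}
    (h : ∀ i j : Fin 2, g.1 (.inl i) (.inl j) = g'.1 (.inl i) (.inl j) ∧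
      g.1 (.inl i) (.inr j) = g'.1 (.inl i) (.inr j) ∧
      g.1 (.inr i) (.inl j) = g'.1 (.inr i) (.inl j) ∧
      g.1 (.inr i) (.inr j) = g'.1 (.inr i) (.inr j)) : g = g' := by
  refine Subtype.ext (Matrix.ext ?_)
  rintro (i | i) (j | j)
  exacts [(h i j).1, (h i j).2.1, (h i j).2.2.1, (h i j).2.2.2]

theorem Sp4.mul_apply (g g' : Sp4 R) (i j : Fin 2 ⊕ Fin 2) :
    (g * g').1 i j = g.1 i (.inl 0) * g'.1 (.inl 0) j + g.1 i (.inl 1) * g'.1 (.inl 1) j +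
      (g.1 i (.inr 0) * g'.1 (.inr 0) j + g.1 i (.inr 1) * g'.1 (.inr 1) j) := by
  change (g.1 * g'.1) i j = _
  simp [Matrix.mul_apply, Fintype.sum_sum_type, Fin.sum_univ_two]

/-- The subgroup `SL₂(R)` of the long roots `±2e₁`, acting on the first and third coordinates. -/
def longEmb₁ : SL(2, R) →* Sp4 R where
  toFun A := ⟨Matrix.fromBlocks !![A 0 0, 0; 0, 1] !![A 0 1, 0; 0, 0] !![A 1 0, 0; 0, 0]
    !![A 1 1, 0; 0, 1], by
    have := det_SL2 A
    rw [mem_Sp4_iff, Matrix.fromBlocks_transpose, Matrix.fromBlocks_multiply,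
      Matrix.fromBlocks_multiply, Matrix.fromBlocks_inj]
    refine ⟨?_, ?_, ?_, ?_⟩ <;> ext i j <;> fin_cases i <;> fin_cases j <;>
      simp [Matrix.mul_apply, Fin.sum_univ_two] <;>
      first | ring1 | linear_combination this | linear_combination -this⟩
  map_one' := by
    refine Sp4.ext_entries fun i j => ?_
    fin_cases i <;> fin_cases j <;> simp
  map_mul' A B := by
    refine Sp4.ext_entries fun i j => ?_
    simp only [Sp4.mul_apply]
    fin_cases i <;> fin_cases j <;> simp [Matrix.mul_apply, Fin.sum_univ_two]

/-- The subgroup `SL₂(R)` of the long roots `±2e₂`, acting on the second and fourth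
coordinates. -/
def longEmb₂ : SL(2, R) →* Sp4 R where
  toFun A := ⟨Matrix.fromBlocks !![1, 0; 0, A 0 0] !![0, 0; 0, A 0 1] !![0, 0; 0, A 1 0]
    !![1, 0; 0, A 1 1], by
    have := det_SL2 A
    rw [mem_Sp4_iff, Matrix.fromBlocks_transpose, Matrix.fromBlocks_multiply,
      Matrix.fromBlocks_multiply, Matrix.fromBlocks_inj]
    refine ⟨?_, ?_, ?_, ?_⟩ <;> ext i j <;> fin_cases i <;> fin_cases j <;>
      simp [Matrix.mul_apply, Fin.sum_univ_two] <;>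
      first | ring1 | linear_combination this | linear_combination -this⟩
  map_one' := by
    refine Sp4.ext_entries fun i j => ?_
    fin_cases i <;> fin_cases j <;> simp
  map_mul' A B := by
    refine Sp4.ext_entries fun i j => ?_
    simp only [Sp4.mul_apply]
    fin_cases i <;> fin_cases j <;> simp [Matrix.mul_apply, Fin.sum_univ_two]

/-- The subgroup `SL₂(R)` of the short roots `±(e₁ - e₂)`, embedded by
`A ↦ diag(A, (A⁻¹)ᵀ)`. -/
def shortEmb : SL(2, R) →* Sp4 R where
  toFun A := ⟨Matrix.fromBlocks !![A 0 0, A 0 1; A 1 0, A 1 1] 0 0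
    !![A 1 1, -A 1 0; -A 0 1, A 0 0], by
    have := det_SL2 A
    rw [mem_Sp4_iff, Matrix.fromBlocks_transpose, Matrix.fromBlocks_multiply,
      Matrix.fromBlocks_multiply, Matrix.fromBlocks_inj]
    refine ⟨?_, ?_, ?_, ?_⟩ <;> ext i j <;> fin_cases i <;> fin_cases j <;>
      simp [Matrix.mul_apply, Fin.sum_univ_two] <;>
      first | ring1 | linear_combination this | linear_combination -this⟩
  map_one' := by
    refine Sp4.ext_entries fun i j => ?_
    fin_cases i <;> fin_cases j <;> simp
  map_mul' A B := by
    refine Sp4.ext_entries fun i j => ?_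
    simp only [Sp4.mul_apply]
    fin_cases i <;> fin_cases j <;> simp [Matrix.mul_apply, Fin.sum_univ_two] <;> ring

theorem longEmb₁_val (A : SL(2, R)) : (longEmb₁ A).1 =
    Matrix.fromBlocks !![A 0 0, 0; 0, 1] !![A 0 1, 0; 0, 0] !![A 1 0, 0; 0, 0]
      !![A 1 1, 0; 0, 1] := rfl

theorem longEmb₂_val (A : SL(2, R)) : (longEmb₂ A).1 =
    Matrix.fromBlocks !![1, 0; 0, A 0 0] !![0, 0; 0, A 0 1] !![0, 0; 0, A 1 0]
      !![1, 0; 0, A 1 1] := rfl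

theorem shortEmb_val (A : SL(2, R)) : (shortEmb A).1 =
    Matrix.fromBlocks !![A 0 0, A 0 1; A 1 0, A 1 1] 0 0
      !![A 1 1, -A 1 0; -A 0 1, A 0 0] := rfl

theorem rootElement_val (φ : RootC2) (x : R) : (rootElement φ x).1 = rootMatrix φ x := rfl

/-- The Weyl group element of the root `e₁ - e₂`, which interchanges the two long root
subgroups. -/
def weylShort : Sp4 R :=
  rootElement .shortDiff 1 * rootElement .negShortDiff (-1) * rootElement .shortDiff 1

theorem longEmb₁_mul_longEmb₂ (A B : SL(2, R)) :
    longEmb₁ A * longEmb₂ B = longEmb₂ B * longEmb₁ A := by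
  refine Sp4.ext_entries fun i j => ?_
  simp only [Sp4.mul_apply, longEmb₁_val, longEmb₂_val]
  fin_cases i <;> fin_cases j <;> simp

theorem weylShort_mul_longEmb₁ (A : SL(2, R)) :
    weylShort * longEmb₁ A = longEmb₂ A * weylShort := by
  refine Sp4.ext_entries fun i j => ?_
  simp only [weylShort, Sp4.mul_apply, longEmb₁_val, longEmb₂_val, rootElement_val, rootMatrix]
  fin_cases i <;> fin_cases j <;> simp

section Conjugation

variable (A : SL(2, R)) (x : R)

theorem longEmb₁_mul_shortDiff : longEmb₁ A * rootElement .shortDiff x =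
    rootElement .shortDiff (x * (A 0 0 - 1)) * rootElement .negShortSum (x * A 1 0) *
      rootElement (.negLong 1) (x ^ 2 * A 1 0 * (A 0 0 - 2)) *
      (rootElement .shortDiff x * longEmb₁ A) := by
  have := det_SL2 A
  refine Sp4.ext_entries fun i j => ?_
  simp only [Sp4.mul_apply, longEmb₁_val, rootElement_val, rootMatrix]
  fin_cases i <;> fin_cases j <;> simp <;> first | ring1 | (refine ⟨?_, ?_⟩ <;>
    first | ring1 | linear_combination x * this)

theorem longEmb₁_mul_shortSum : longEmb₁ A * rootElement .shortSum x =
    rootElement .shortSum (x * (A 0 0 - 1)) * rootElement .negShortDiff (-(x * A 1 0)) *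
      rootElement (.long 1) (-(x ^ 2 * A 1 0 * (A 0 0 - 2))) *
      (rootElement .shortSum x * longEmb₁ A) := by
  have := det_SL2 A
  refine Sp4.ext_entries fun i j => ?_
  simp only [Sp4.mul_apply, longEmb₁_val, rootElement_val, rootMatrix]
  fin_cases i <;> fin_cases j <;> simp <;> first | ring1 | (refine ⟨?_, ?_⟩ <;>
    first | ring1 | linear_combination x * this | linear_combination -x * this)

theorem longEmb₁_mul_negShortSum : longEmb₁ A * rootElement .negShortSum x =
    rootElement .negShortSum (x * (A 1 1 - 1)) * rootElement .shortDiff (x * A 0 1) *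
      rootElement (.negLong 1) (x ^ 2 * A 0 1 * (2 - A 1 1)) *
      (rootElement .negShortSum x * longEmb₁ A) := by
  have := det_SL2 A
  refine Sp4.ext_entries fun i j => ?_
  simp only [Sp4.mul_apply, longEmb₁_val, rootElement_val, rootMatrix]
  fin_cases i <;> fin_cases j <;> simp <;> first | ring1 | (refine ⟨?_, ?_⟩ <;>
    first | ring1 | linear_combination x * this | linear_combination -x * this)

theorem longEmb₁_mul_negShortDiff : longEmb₁ A * rootElement .negShortDiff x =
    rootElement .negShortDiff (x * (A 1 1 - 1)) * rootElement .shortSum (-(x * A 0 1)) *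
      rootElement (.long 1) (-(x ^ 2 * A 0 1 * (2 - A 1 1))) *
      (rootElement .negShortDiff x * longEmb₁ A) := by
  have := det_SL2 A
  refine Sp4.ext_entries fun i j => ?_
  simp only [Sp4.mul_apply, longEmb₁_val, rootElement_val, rootMatrix]
  fin_cases i <;> fin_cases j <;> simp <;> first | ring1 | (refine ⟨?_, ?_⟩ <;>
    first | ring1 | linear_combination x * this | linear_combination -x * this)

theorem longEmb₁_mul_long_one : longEmb₁ A * rootElement (.long 1) x =
    rootElement (.long 1) x * longEmb₁ A := by
  refine Sp4.ext_entries fun i j => ?_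
  simp only [Sp4.mul_apply, longEmb₁_val, rootElement_val, rootMatrix]
  fin_cases i <;> fin_cases j <;> simp

theorem longEmb₁_mul_negLong_one : longEmb₁ A * rootElement (.negLong 1) x =
    rootElement (.negLong 1) x * longEmb₁ A := by
  refine Sp4.ext_entries fun i j => ?_
  simp only [Sp4.mul_apply, longEmb₁_val, rootElement_val, rootMatrix]
  fin_cases i <;> fin_cases j <;> simp

theorem long_zero_eq : rootElement (.long 0) x =
    rootElement .shortSum (-x) * rootElement (.long 1) (-x) * rootElement .shortDiff 1 *
      rootElement (.long 1) x * rootElement .shortDiff (-1) := by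
  refine Sp4.ext_entries fun i j => ?_
  simp only [Sp4.mul_apply, rootElement_val, rootMatrix]
  fin_cases i <;> fin_cases j <;> simp

theorem negLong_zero_eq : rootElement (.negLong 0) x =
    rootElement .negShortSum x * rootElement (.negLong 1) (-x) * rootElement .negShortDiff 1 *
      rootElement (.negLong 1) x * rootElement .negShortDiff (-1) := by
  refine Sp4.ext_entries fun i j => ?_
  simp only [Sp4.mul_apply, rootElement_val, rootMatrix]
  fin_cases i <;> fin_cases j <;> simp

end Conjugation

section Quotient

variable {I : Ideal R}

theorem rootElement_mem_elementarySp4 (φ : RootC2) {x : R} (hx : x ∈ I) :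
    rootElement φ x ∈ elementarySp4 I :=
  Subgroup.subset_normalClosure ⟨φ, x, hx, rfl⟩

/-- The projection from `Sp₄(R)` modulo `E(C₂, R, I)`. -/
abbrev toQuot (I : Ideal R) : Sp4 R →* Sp4 R ⧸ elementarySp4 I := QuotientGroup.mk' _

theorem toQuot_eq_one {g : Sp4 R} : toQuot I g = 1 ↔ g ∈ elementarySp4 I :=
  QuotientGroup.eq_one_iff g

theorem toQuot_root (φ : RootC2) {x : R} (hx : x ∈ I) : toQuot I (rootElement φ x) = 1 :=
  toQuot_eq_one.2 (rootElement_mem_elementarySp4 φ hx)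

/-- Modulo `E(C₂, R, I)`, the congruence subgroup of the long root subgroup `SL₂(R)` commutes with
all root elements: it normalizes the two Heisenberg groups generated by the root elements of
`{e₁ - e₂, -e₁ - e₂, -2e₂}` and of the opposite roots, acting on them trivially modulo `I`, and
these groups generate all root elements. -/
theorem commute_longEmb₁_root {A : SL(2, R)} (hA : A ∈ congruenceSL2 I) (φ : RootC2) (x : R) :
    Commute (toQuot I (longEmb₁ A)) (toQuot I (rootElement φ x)) := by
  obtain ⟨ha, hb, hc, hd⟩ := mem_congruenceSL2_iff.1 hA
  have sd : ∀ x, Commute (toQuot I (longEmb₁ A)) (toQuot I (rootElement .shortDiff x)) := by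
    intro x
    rw [Commute, SemiconjBy, ← map_mul, longEmb₁_mul_shortDiff, map_mul, map_mul, map_mul,
      toQuot_root _ (I.mul_mem_left _ ha), toQuot_root _ (I.mul_mem_left _ hc),
      toQuot_root _ (I.mul_mem_right _ (I.mul_mem_left _ hc))]
    simp
  have ss : ∀ x, Commute (toQuot I (longEmb₁ A)) (toQuot I (rootElement .shortSum x)) := by
    intro x
    rw [Commute, SemiconjBy, ← map_mul, longEmb₁_mul_shortSum, map_mul, map_mul, map_mul,
      toQuot_root _ (I.mul_mem_left _ ha), toQuot_root _ (neg_mem (I.mul_mem_left _ hc)),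
      toQuot_root _ (neg_mem (I.mul_mem_right _ (I.mul_mem_left _ hc)))]
    simp
  have nss : ∀ x, Commute (toQuot I (longEmb₁ A)) (toQuot I (rootElement .negShortSum x)) := by
    intro x
    rw [Commute, SemiconjBy, ← map_mul, longEmb₁_mul_negShortSum, map_mul, map_mul, map_mul,
      toQuot_root _ (I.mul_mem_left _ hd), toQuot_root _ (I.mul_mem_left _ hb),
      toQuot_root _ (I.mul_mem_right _ (I.mul_mem_left _ hb))]
    simp
  have nsd : ∀ x, Commute (toQuot I (longEmb₁ A)) (toQuot I (rootElement .negShortDiff x)) := by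
    intro x
    rw [Commute, SemiconjBy, ← map_mul, longEmb₁_mul_negShortDiff, map_mul, map_mul, map_mul,
      toQuot_root _ (I.mul_mem_left _ hd), toQuot_root _ (neg_mem (I.mul_mem_left _ hb)),
      toQuot_root _ (neg_mem (I.mul_mem_right _ (I.mul_mem_left _ hb)))]
    simp
  have l1 : ∀ x, Commute (toQuot I (longEmb₁ A)) (toQuot I (rootElement (.long 1) x)) := by
    intro x
    rw [Commute, SemiconjBy, ← map_mul, longEmb₁_mul_long_one, map_mul]
  have nl1 : ∀ x, Commute (toQuot I (longEmb₁ A)) (toQuot I (rootElement (.negLong 1) x)) := by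
    intro x
    rw [Commute, SemiconjBy, ← map_mul, longEmb₁_mul_negLong_one, map_mul]
  match φ with
  | .long 0 =>
    rw [long_zero_eq, map_mul, map_mul, map_mul, map_mul]
    exact ((((ss _).mul_right (l1 _)).mul_right (sd _)).mul_right (l1 _)).mul_right (sd _)
  | .long 1 => exact l1 x
  | .negLong 0 =>
    rw [negLong_zero_eq, map_mul, map_mul, map_mul, map_mul]
    exact ((((nss _).mul_right (nl1 _)).mul_right (nsd _)).mul_right (nl1 _)).mul_right (nsd _)
  | .negLong 1 => exact nl1 x
  | .shortSum => exact ss x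
  | .negShortSum => exact nss x
  | .shortDiff => exact sd x
  | .negShortDiff => exact nsd x

theorem toQuot_longEmb₂ {A : SL(2, R)} (hA : A ∈ congruenceSL2 I) :
    toQuot I (longEmb₂ A) = toQuot I (longEmb₁ A) := by
  have hc : Commute (toQuot I (longEmb₁ A)) (toQuot I weylShort) := by
    rw [weylShort, map_mul, map_mul]
    exact ((commute_longEmb₁_root hA _ _).mul_right (commute_longEmb₁_root hA _ _)).mul_right
      (commute_longEmb₁_root hA _ _)
  have h := congrArg (toQuot I) (weylShort_mul_longEmb₁ A)
  rw [map_mul, map_mul, ← hc.eq] at h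
  exact (mul_right_cancel h).symm

end Quotient

end Embeddings

/-! ### Generation of the congruence subgroup by a long root subgroup -/

section Generation

variable {R : Type*} [CommRing R] {I : Ideal R}

/-- The columns of a symplectic matrix form a symplectic basis. -/
theorem Sp4.form_columns (g : Sp4 R) (j k : Fin 2 ⊕ Fin 2) :
    g.1 (.inl 0) j * g.1 (.inr 0) k + g.1 (.inl 1) j * g.1 (.inr 1) k -
      g.1 (.inr 0) j * g.1 (.inl 0) k - g.1 (.inr 1) j * g.1 (.inl 1) k =
      (Matrix.fromBlocks 0 1 (-1) 0 : Matrix (Fin 2 ⊕ Fin 2) (Fin 2 ⊕ Fin 2) R) j k := by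
  rw [← (mem_Sp4_iff g.1).1 g.2]
  simp [Matrix.mul_apply, Fintype.sum_sum_type, Fin.sum_univ_two, Matrix.fromBlocks,
    Matrix.one_apply]
  ring

theorem mem_congruenceSp4_iff {g : Sp4 R} :
    g ∈ congruenceSp4 I ↔
      ∀ i j, g.1 i j - (1 : Matrix (Fin 2 ⊕ Fin 2) (Fin 2 ⊕ Fin 2) R) i j ∈ I := by
  rw [congruenceSp4, MonoidHom.mem_ker, Subtype.ext_iff, ← Matrix.ext_iff]
  refine forall₂_congr fun i j => ?_
  rw [← Ideal.Quotient.eq]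
  by_cases h : i = j
  · subst h; simp [sp4Map]
  · simp [sp4Map, h]

theorem longEmb₁_mem {A : SL(2, R)} (hA : A ∈ congruenceSL2 I) :
    longEmb₁ A ∈ congruenceSp4 I := by
  obtain ⟨ha, hb, hc, hd⟩ := mem_congruenceSL2_iff.1 hA
  rw [mem_congruenceSp4_iff, longEmb₁_val]
  rintro (i | i) (j | j) <;> fin_cases i <;> fin_cases j <;> simp [ha, hb, hc, hd]

theorem longEmb₂_mem {A : SL(2, R)} (hA : A ∈ congruenceSL2 I) :
    longEmb₂ A ∈ congruenceSp4 I := by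
  obtain ⟨ha, hb, hc, hd⟩ := mem_congruenceSL2_iff.1 hA
  rw [mem_congruenceSp4_iff, longEmb₂_val]
  rintro (i | i) (j | j) <;> fin_cases i <;> fin_cases j <;> simp [ha, hb, hc, hd]

theorem shortEmb_mem {A : SL(2, R)} (hA : A ∈ congruenceSL2 I) :
    shortEmb A ∈ congruenceSp4 I := by
  obtain ⟨ha, hb, hc, hd⟩ := mem_congruenceSL2_iff.1 hA
  rw [mem_congruenceSp4_iff, shortEmb_val]
  rintro (i | i) (j | j) <;> fin_cases i <;> fin_cases j <;> simp [ha, hb, hc, hd]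

theorem rootElement_mem_congruenceSp4 (φ : RootC2) {x : R} (hx : x ∈ I) :
    rootElement φ x ∈ congruenceSp4 I :=
  elementarySp4_le_congruenceSp4 I (rootElement_mem_elementarySp4 φ hx)

theorem toQuot_root_mul (φ : RootC2) {x : R} (hx : x ∈ I) (g : Sp4 R) :
    toQuot I (rootElement φ x * g) = toQuot I g := by
  rw [map_mul, toQuot_root φ hx, one_mul]

/-- The stabilizer of the first basis vector in `C(C₂, R, I)` is the product of a Heisenberg group
contained in `E(C₂, R, I)` and a long root subgroup. -/
theorem exists_longEmb₂_of_column_eq {g : Sp4 R} (hg : g ∈ congruenceSp4 I)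
    (h00 : g.1 (.inl 0) (.inl 0) = 1) (h10 : g.1 (.inl 1) (.inl 0) = 0)
    (h20 : g.1 (.inr 0) (.inl 0) = 0) (h30 : g.1 (.inr 1) (.inl 0) = 0) :
    ∃ N ∈ congruenceSL2 I, N 0 0 = g.1 (.inl 1) (.inl 1) ∧
      toQuot I g = toQuot I (longEmb₁ N) := by
  have hI := mem_congruenceSp4_iff.1 hg
  have e1 := Sp4.form_columns g (.inl 0) (.inr 0)
  have e2 := Sp4.form_columns g (.inl 0) (.inl 1)
  have e3 := Sp4.form_columns g (.inl 0) (.inr 1)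
  have e4 := Sp4.form_columns g (.inl 1) (.inr 1)
  have e5 := Sp4.form_columns g (.inl 1) (.inr 0)
  have e6 := Sp4.form_columns g (.inr 1) (.inr 0)
  simp [h00, h10, h20, h30] at e1 e2 e3
  simp [e1, e2, e3] at e4 e5 e6
  set N := mkSL2 (g.1 (.inl 1) (.inl 1)) (g.1 (.inl 1) (.inr 1)) (g.1 (.inr 1) (.inl 1))
    (g.1 (.inr 1) (.inr 1)) (by linear_combination e4)
  have hN : N ∈ congruenceSL2 I := by
    rw [mem_congruenceSL2_iff]
    have h11 := hI (.inl 1) (.inl 1)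
    have h13 := hI (.inl 1) (.inr 1)
    have h31 := hI (.inr 1) (.inl 1)
    have h33 := hI (.inr 1) (.inr 1)
    simp only [Matrix.one_apply, reduceCtorEq, if_false, if_true, sub_zero] at h11 h13 h31 h33
    exact ⟨h11, h13, h31, h33⟩
  have hκ : g.1 (.inl 1) (.inr 0) ∈ I := by simpa using hI (.inl 1) (.inr 0)
  have hlam : g.1 (.inr 1) (.inr 0) ∈ I := by simpa using hI (.inr 1) (.inr 0)
  have hr : g.1 (.inl 0) (.inr 0) ∈ I := by simpa using hI (.inl 0) (.inr 0)
  refine ⟨N, hN, rfl, ?_⟩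
  have key : g = rootElement .shortDiff (-g.1 (.inr 1) (.inr 0)) *
      (rootElement .shortSum (g.1 (.inl 1) (.inr 0)) *
      (rootElement (.long 0) (g.1 (.inl 0) (.inr 0) +
        g.1 (.inl 1) (.inr 0) * g.1 (.inr 1) (.inr 0)) * longEmb₂ N)) := by
    refine Sp4.ext_entries ?_
    simp only [Sp4.mul_apply, longEmb₂_val, rootElement_val, rootMatrix, Fin.forall_fin_two]
    simp [N, mkSL2_val, h00, h10, h20, h30, e1, e2, e3]
    refine ⟨?_, ?_, ?_⟩
    · ring1
    · linear_combination e5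
    · linear_combination e6
  rw [key, toQuot_root_mul _ (neg_mem hlam), toQuot_root_mul _ hκ,
    toQuot_root_mul _ (add_mem hr (I.mul_mem_left _ hlam)), toQuot_longEmb₂ hN]

/-- A first column `(1, x, 0, z)` is reduced to `(1, 0, 0, 0)` by root elements of `I`. The entry
`N 0 0` is recorded because it decides whether `N` is elementary. -/
theorem exists_longEmb₁_of_column {g : Sp4 R} (hg : g ∈ congruenceSp4 I)
    (h00 : g.1 (.inl 0) (.inl 0) = 1) (h20 : g.1 (.inr 0) (.inl 0) = 0) :
    ∃ N ∈ congruenceSL2 I,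
      N 0 0 = g.1 (.inl 1) (.inl 1) - g.1 (.inl 1) (.inl 0) * g.1 (.inl 0) (.inl 1) ∧
      toQuot I g = toQuot I (longEmb₁ N) := by
  have hI := mem_congruenceSp4_iff.1 hg
  have hx : g.1 (.inl 1) (.inl 0) ∈ I := by simpa using hI (.inl 1) (.inl 0)
  have hz : g.1 (.inr 1) (.inl 0) ∈ I := by simpa using hI (.inr 1) (.inl 0)
  set x := g.1 (.inl 1) (.inl 0) with hxe
  set z := g.1 (.inr 1) (.inl 0) with hze
  have hxz : -(x * z) ∈ I := neg_mem (I.mul_mem_left _ hz)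
  obtain ⟨N, hN, hN0, hNq⟩ := exists_longEmb₂_of_column_eq
    (g := rootElement (.negLong 0) (-(x * z)) * (rootElement .negShortSum (-z) *
      (rootElement .negShortDiff (-x) * g)))
    (mul_mem (rootElement_mem_congruenceSp4 _ hxz) (mul_mem
      (rootElement_mem_congruenceSp4 _ (neg_mem hz)) (mul_mem
      (rootElement_mem_congruenceSp4 _ (neg_mem hx)) hg)))
    (by simp [Sp4.mul_apply, rootElement_val, rootMatrix, h00])
    (by simp [Sp4.mul_apply, rootElement_val, rootMatrix, h00, ← hxe])
    (by simp [Sp4.mul_apply, rootElement_val, rootMatrix, h00, h20, ← hxe, ← hze])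
    (by simp [Sp4.mul_apply, rootElement_val, rootMatrix, h00, ← hze])
  rw [toQuot_root_mul _ hxz, toQuot_root_mul _ (neg_mem hz), toQuot_root_mul _ (neg_mem hx)] at hNq
  refine ⟨N, hN, ?_, hNq⟩
  rw [hN0]
  simp [Sp4.mul_apply, rootElement_val, rootMatrix]
  ring

theorem longEmb₁_inv_mul_apply (A : SL(2, R)) (g : Sp4 R) (j : Fin 2 ⊕ Fin 2) :
    (longEmb₁ A⁻¹ * g).1 (.inl 0) j = A 1 1 * g.1 (.inl 0) j - A 0 1 * g.1 (.inr 0) j ∧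
    (longEmb₁ A⁻¹ * g).1 (.inr 0) j = A 0 0 * g.1 (.inr 0) j - A 1 0 * g.1 (.inl 0) j ∧
    (longEmb₁ A⁻¹ * g).1 (.inl 1) j = g.1 (.inl 1) j ∧
    (longEmb₁ A⁻¹ * g).1 (.inr 1) j = g.1 (.inr 1) j := by
  have h00 : A⁻¹ 0 0 = A 1 1 := by rw [Matrix.SpecialLinearGroup.SL2_inv_expl]; rfl
  have h01 : A⁻¹ 0 1 = -A 0 1 := by rw [Matrix.SpecialLinearGroup.SL2_inv_expl]; rfl
  have h10 : A⁻¹ 1 0 = -A 1 0 := by rw [Matrix.SpecialLinearGroup.SL2_inv_expl]; rfl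
  have h11 : A⁻¹ 1 1 = A 0 0 := by rw [Matrix.SpecialLinearGroup.SL2_inv_expl]; rfl
  simp only [Sp4.mul_apply, longEmb₁_val, h00, h01, h10, h11]
  simp
  refine ⟨?_, ?_⟩ <;> ring

theorem exists_longEmb₁_of_isCoprime {g : Sp4 R} (hg : g ∈ congruenceSp4 I)
    (h : IsCoprime (g.1 (.inl 0) (.inl 0)) (g.1 (.inr 0) (.inl 0))) :
    ∃ N ∈ congruenceSL2 I, toQuot I g = toQuot I (longEmb₁ N) := by
  have hI := mem_congruenceSp4_iff.1 hg
  obtain ⟨A, hA, hA0, hA1⟩ := exists_mem_congruenceSL2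
    (by simpa using hI (.inr 0) (.inl 0)) (by simpa using hI (.inl 0) (.inl 0)) h
  have hdet := det_SL2 A
  obtain ⟨f0, f2, -, -⟩ := longEmb₁_inv_mul_apply A g (.inl 0)
  rw [← hA0, ← hA1] at f0 f2
  obtain ⟨N, hN, -, hNq⟩ := exists_longEmb₁_of_column
    (mul_mem (longEmb₁_mem (inv_mem hA)) hg) (by rw [f0]; linear_combination hdet)
    (by rw [f2]; ring)
  refine ⟨A * N, mul_mem hA hN, ?_⟩
  rw [map_mul longEmb₁, map_mul, ← hNq, ← map_mul, map_inv, mul_inv_cancel_left]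

theorem exists_longEmb₁_of_conj {g h : Sp4 R}
    (hh : ∀ N ∈ congruenceSL2 I, Commute (toQuot I (longEmb₁ N)) (toQuot I h))
    (H : ∃ N ∈ congruenceSL2 I, toQuot I (h * g * h⁻¹) = toQuot I (longEmb₁ N)) :
    ∃ N ∈ congruenceSL2 I, toQuot I g = toQuot I (longEmb₁ N) := by
  obtain ⟨N, hN, e⟩ := H
  refine ⟨N, hN, ?_⟩
  rw [map_mul, map_mul, map_inv, mul_inv_eq_iff_eq_mul, (hh N hN).eq] at e
  exact mul_left_cancel e

theorem rootElement_neg (φ : RootC2) (x : R) : rootElement φ (-x) = (rootElement φ x)⁻¹ := by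
  rw [eq_inv_iff_mul_eq_one]
  refine Sp4.ext_entries ?_
  simp only [Sp4.mul_apply, Fin.forall_fin_two, rootElement_val]
  rcases φ with i | i | _ | _ | _ | _
  · fin_cases i <;> simp [rootMatrix]
  · fin_cases i <;> simp [rootMatrix]
  all_goals simp [rootMatrix]

/-- Conjugation by elements of the Heisenberg group that fixes the first basis vector adds multiples
of the second and fourth entries of the first column to its first entry, up to multiples of the
third. Stable range one modulo the third entry then makes the first and third entries coprime. -/
theorem exists_longEmb₁_of_ne_zero (hsr : StableRangeLEThreeHalves R) {g : Sp4 R}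
    (hg : g ∈ congruenceSp4 I) (hy : g.1 (.inr 0) (.inl 0) ≠ 0) :
    ∃ N ∈ congruenceSL2 I, toQuot I g = toQuot I (longEmb₁ N) := by
  have e1 := Sp4.form_columns g (.inl 0) (.inr 0)
  simp at e1
  set a := g.1 (.inl 0) (.inl 0)
  set x := g.1 (.inl 1) (.inl 0)
  set y := g.1 (.inr 0) (.inl 0)
  set z := g.1 (.inr 1) (.inl 0)
  set β := g.1 (.inr 1) (.inr 0)
  set γ := g.1 (.inl 1) (.inr 0)
  obtain ⟨k, hk⟩ := hsr.exists_isCoprime (a := a) (b := β * x - γ * z) hy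
    ⟨g.1 (.inr 0) (.inr 0), 1, -g.1 (.inl 0) (.inr 0), by linear_combination e1⟩
  set h := rootElement .shortSum (-(k * γ)) * rootElement .shortDiff (k * β) with hh
  have hinv : h⁻¹ = rootElement .shortDiff (-(k * β)) * rootElement .shortSum (k * γ) := by
    rw [hh, mul_inv_rev, ← rootElement_neg, ← rootElement_neg, neg_neg]
  refine exists_longEmb₁_of_conj (h := h) ?_ (exists_longEmb₁_of_isCoprime
    ((MonoidHom.normal_ker _).conj_mem g hg h) ?_)
  · intro N hN
    rw [hh, map_mul]
    exact (commute_longEmb₁_root hN _ _).mul_right (commute_longEmb₁_root hN _ _)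
  · have f0 : (h * g * h⁻¹).1 (.inl 0) (.inl 0) =
        a + k * (β * x - γ * z) + y * (k * γ * (k * β)) := by
      rw [hinv]
      simp [hh, Sp4.mul_apply, rootElement_val, rootMatrix]
      ring
    have f2 : (h * g * h⁻¹).1 (.inr 0) (.inl 0) = y := by
      rw [hinv]
      simp [hh, Sp4.mul_apply, rootElement_val, rootMatrix, y]
    rw [f0, f2]
    exact hk.add_mul_left_left _

/-- Under stable range `3/2` the quotient `C(C₂, R, I) / E(C₂, R, I)` is covered by a long root
subgroup: the first column of a matrix can be changed so that its third entry is non-zero, next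
(modulo that entry) so that its first and third entries generate the unit ideal. -/
theorem exists_longEmb₁ (hI : I ≠ ⊥) (hsr : StableRangeLEThreeHalves R) {g : Sp4 R}
    (hg : g ∈ congruenceSp4 I) :
    ∃ N ∈ congruenceSL2 I, toQuot I g = toQuot I (longEmb₁ N) := by
  by_cases hy : g.1 (.inr 0) (.inl 0) = 0
  swap
  · exact exists_longEmb₁_of_ne_zero hsr hg hy
  obtain ⟨i, hi, hi0⟩ := Submodule.exists_mem_ne_zero_of_ne_bot hI
  have step : ∀ φ (x : R), x ∈ I → (rootElement φ x * g).1 (.inr 0) (.inl 0) ≠ 0 →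
      ∃ N ∈ congruenceSL2 I, toQuot I g = toQuot I (longEmb₁ N) := by
    intro φ x hx hne
    rw [← toQuot_root_mul φ hx g]
    exact exists_longEmb₁_of_ne_zero hsr (mul_mem (rootElement_mem_congruenceSp4 _ hx) hg) hne
  by_contra hcon
  have h1 : i * g.1 (.inl 0) (.inl 0) = 0 := by
    by_contra hne
    refine hcon (step (.negLong 0) i hi ?_)
    simpa [Sp4.mul_apply, rootElement_val, rootMatrix, hy] using hne
  have h2 : i * g.1 (.inl 1) (.inl 0) = 0 := by
    by_contra hne
    refine hcon (step .negShortSum i hi ?_)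
    simpa [Sp4.mul_apply, rootElement_val, rootMatrix, hy] using hne
  have h3 : i * g.1 (.inr 1) (.inl 0) = 0 := by
    by_contra hne
    refine hcon (step .negShortDiff (-i) (neg_mem hi) ?_)
    simpa [Sp4.mul_apply, rootElement_val, rootMatrix, hy] using hne
  have e1 := Sp4.form_columns g (.inl 0) (.inr 0)
  simp [hy] at e1
  refine hi0 ?_
  linear_combination g.1 (.inr 0) (.inr 0) * h1 + g.1 (.inr 1) (.inr 0) * h2 -
    g.1 (.inl 1) (.inr 0) * h3 - i * e1

end Generation

/-! ### The symbols of `Sp₄` -/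

section Classes

variable {R : Type*} [CommRing R] {I : Ideal R}

/-- Every root element commutes with `C(C₂, R, I)` modulo `E(C₂, R, I)`. -/
theorem commute_root (hI : I ≠ ⊥) (hsr : StableRangeLEThreeHalves R) {g : Sp4 R}
    (hg : g ∈ congruenceSp4 I) (φ : RootC2) (x : R) :
    Commute (toQuot I g) (toQuot I (rootElement φ x)) := by
  obtain ⟨N, hN, e⟩ := exists_longEmb₁ hI hsr hg
  rw [e]
  exact commute_longEmb₁_root hN φ x

theorem mk_eq_mk_iff {g g' : congruenceSp4 I} :
    (QuotientGroup.mk g : CongruenceQuotientSp4 I) = QuotientGroup.mk g' ↔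
      toQuot I g = toQuot I g' := by
  rw [QuotientGroup.eq, Subgroup.mem_subgroupOf]
  exact (QuotientGroup.eq (s := elementarySp4 I)).symm

/-- The quotient is commutative, because it is the image of each of the two commuting long root
subgroups. -/
abbrev quotientCommGroup (hI : I ≠ ⊥) (hsr : StableRangeLEThreeHalves R) :
    CommGroup (CongruenceQuotientSp4 I) where
  mul_comm x y := by
    obtain ⟨⟨g, hg⟩, rfl⟩ := QuotientGroup.mk_surjective x
    obtain ⟨⟨g', hg'⟩, rfl⟩ := QuotientGroup.mk_surjective y
    obtain ⟨N, hN, e⟩ := exists_longEmb₁ hI hsr hg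
    obtain ⟨N', hN', e'⟩ := exists_longEmb₁ hI hsr hg'
    rw [← QuotientGroup.mk_mul, ← QuotientGroup.mk_mul, mk_eq_mk_iff]
    simp only [Subgroup.coe_mul, map_mul]
    rw [e, e', ← toQuot_longEmb₂ hN', ← map_mul, longEmb₁_mul_longEmb₂, map_mul]

/-- The upper unitriangular matrix with entry `x`. -/
def upperSL2 (x : R) : SL(2, R) := mkSL2 1 x 0 1 (by ring)

/-- The lower unitriangular matrix with entry `x`. -/
def lowerSL2 (x : R) : SL(2, R) := mkSL2 1 0 x 1 (by ring)

theorem mul_upperSL2 (A : SL(2, R)) (x : R) :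
    (A * upperSL2 x) 0 0 = A 0 0 ∧ (A * upperSL2 x) 0 1 = A 0 0 * x + A 0 1 ∧
    (A * upperSL2 x) 1 0 = A 1 0 ∧ (A * upperSL2 x) 1 1 = A 1 0 * x + A 1 1 := by
  simp [upperSL2, mkSL2_val, Matrix.mul_apply, Fin.sum_univ_two]

theorem mul_lowerSL2 (A : SL(2, R)) (x : R) :
    (A * lowerSL2 x) 0 0 = A 0 0 + A 0 1 * x ∧ (A * lowerSL2 x) 0 1 = A 0 1 ∧
    (A * lowerSL2 x) 1 0 = A 1 0 + A 1 1 * x ∧ (A * lowerSL2 x) 1 1 = A 1 1 := by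
  simp [lowerSL2, mkSL2_val, Matrix.mul_apply, Fin.sum_univ_two]

theorem upperSL2_mul (A : SL(2, R)) (x : R) :
    (upperSL2 x * A) 0 0 = A 0 0 + x * A 1 0 ∧ (upperSL2 x * A) 0 1 = A 0 1 + x * A 1 1 ∧
    (upperSL2 x * A) 1 0 = A 1 0 ∧ (upperSL2 x * A) 1 1 = A 1 1 := by
  simp [upperSL2, mkSL2_val, Matrix.mul_apply, Fin.sum_univ_two]

theorem lowerSL2_mul (A : SL(2, R)) (x : R) :
    (lowerSL2 x * A) 0 0 = A 0 0 ∧ (lowerSL2 x * A) 0 1 = A 0 1 ∧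
    (lowerSL2 x * A) 1 0 = x * A 0 0 + A 1 0 ∧ (lowerSL2 x * A) 1 1 = x * A 0 1 + A 1 1 := by
  simp [lowerSL2, mkSL2_val, Matrix.mul_apply, Fin.sum_univ_two]

theorem upperSL2_neg (x : R) : upperSL2 (-x) = (upperSL2 x)⁻¹ := by
  rw [eq_inv_iff_mul_eq_one]
  ext i j
  fin_cases i <;> fin_cases j <;> simp [upperSL2, mkSL2_val, Matrix.mul_apply, Fin.sum_univ_two]

theorem lowerSL2_neg (x : R) : lowerSL2 (-x) = (lowerSL2 x)⁻¹ := by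
  rw [eq_inv_iff_mul_eq_one]
  ext i j
  fin_cases i <;> fin_cases j <;> simp [lowerSL2, mkSL2_val, Matrix.mul_apply, Fin.sum_univ_two]

theorem lowerSL2_mem {y : R} (hy : y ∈ I) : lowerSL2 y ∈ congruenceSL2 I := by
  rw [mem_congruenceSL2_iff]
  simpa [lowerSL2, mkSL2_val] using hy

instance congruenceSL2_normal : (congruenceSL2 I).Normal := MonoidHom.normal_ker _

theorem exists_mul_upperSL2 {A B : SL(2, R)} (hA : A ∈ congruenceSL2 I)
    (hB : B ∈ congruenceSL2 I) (h0 : A 0 0 = B 0 0) (h1 : A 1 0 = B 1 0) :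
    ∃ y ∈ I, B = A * upperSL2 y := by
  have hA' := mem_congruenceSL2_iff.1 hA
  have hB' := mem_congruenceSL2_iff.1 hB
  have dA := det_SL2 A
  have dB := det_SL2 B
  rw [← h0, ← h1] at dB
  refine ⟨A 1 1 * B 0 1 - A 0 1 * B 1 1,
    sub_mem (I.mul_mem_left _ hB'.2.1) (I.mul_mem_right _ hA'.2.1), ?_⟩
  obtain ⟨f1, f2, f3, f4⟩ := mul_upperSL2 A (A 1 1 * B 0 1 - A 0 1 * B 1 1)
  ext i j
  fin_cases i <;> fin_cases j
  · exact (f1.trans h0).symm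
  · refine Eq.trans ?_ f2.symm
    change B 0 1 = _
    linear_combination A 0 1 * dB - B 0 1 * dA
  · exact (f3.trans h1).symm
  · refine Eq.trans ?_ f4.symm
    change B 1 1 = _
    linear_combination A 1 1 * dB - B 1 1 * dA

theorem exists_lowerSL2_mul {A B : SL(2, R)} (hA : A ∈ congruenceSL2 I)
    (hB : B ∈ congruenceSL2 I) (h0 : A 0 0 = B 0 0) (h1 : A 0 1 = B 0 1) :
    ∃ y ∈ I, B = lowerSL2 y * A := by
  have hA' := mem_congruenceSL2_iff.1 hA
  have hB' := mem_congruenceSL2_iff.1 hB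
  have dA := det_SL2 A
  have dB := det_SL2 B
  rw [← h0, ← h1] at dB
  refine ⟨A 1 1 * B 1 0 - A 1 0 * B 1 1,
    sub_mem (I.mul_mem_left _ hB'.2.2.1) (I.mul_mem_right _ hA'.2.2.1), ?_⟩
  obtain ⟨f1, f2, f3, f4⟩ := lowerSL2_mul A (A 1 1 * B 1 0 - A 1 0 * B 1 1)
  ext i j
  fin_cases i <;> fin_cases j
  · exact (f1.trans h0).symm
  · exact (f2.trans h1).symm
  · refine Eq.trans ?_ f3.symm
    change B 1 0 = _
    linear_combination A 1 0 * dB - B 1 0 * dA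
  · refine Eq.trans ?_ f4.symm
    change B 1 1 = _
    linear_combination A 1 1 * dB - B 1 1 * dA

/-- `E` is a homomorphism `SL₂(R) → Sp₄(R)` onto the subgroup of a pair of opposite roots,
compatible with principal congruence subgroups. -/
structure IsRootEmbedding (E : SL(2, R) →* Sp4 R) (φ ψ : RootC2) : Prop where
  upper : ∀ x, E (upperSL2 x) = rootElement φ x
  lower : ∀ x, E (lowerSL2 x) = rootElement ψ x
  mem : ∀ (I : Ideal R), ∀ A ∈ congruenceSL2 I, E A ∈ congruenceSp4 I

theorem isRootEmbedding_long : IsRootEmbedding (R := R) longEmb₁ (.long 0) (.negLong 0) where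
  upper x := by
    refine Sp4.ext_entries ?_
    simp [longEmb₁_val, rootElement_val, rootMatrix, upperSL2, mkSL2_val]
  lower x := by
    refine Sp4.ext_entries ?_
    simp [longEmb₁_val, rootElement_val, rootMatrix, lowerSL2, mkSL2_val]
  mem _ _ hA := longEmb₁_mem hA

theorem isRootEmbedding_short : IsRootEmbedding (R := R) shortEmb .shortDiff .negShortDiff where
  upper x := by
    refine Sp4.ext_entries ?_
    simp [shortEmb_val, rootElement_val, rootMatrix, upperSL2, mkSL2_val]
  lower x := by
    refine Sp4.ext_entries ?_
    simp [shortEmb_val, rootElement_val, rootMatrix, lowerSL2, mkSL2_val]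
  mem _ _ hA := shortEmb_mem hA

namespace IsRootEmbedding

variable {E : SL(2, R) →* Sp4 R} {φ ψ : RootC2}

theorem toQuot_upper_conj (hE : IsRootEmbedding E φ ψ) (hI : I ≠ ⊥)
    (hsr : StableRangeLEThreeHalves R) {A : SL(2, R)} (hA : A ∈ congruenceSL2 I) (x : R) :
    toQuot I (E (upperSL2 x * A * (upperSL2 x)⁻¹)) = toQuot I (E A) := by
  have := commute_root hI hsr (hE.mem I A hA) φ x
  rw [map_mul, map_mul, map_inv, map_mul, map_mul, map_inv, hE.upper, ← this.eq,
    mul_inv_cancel_right]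

theorem toQuot_lower_conj (hE : IsRootEmbedding E φ ψ) (hI : I ≠ ⊥)
    (hsr : StableRangeLEThreeHalves R) {A : SL(2, R)} (hA : A ∈ congruenceSL2 I) (x : R) :
    toQuot I (E (lowerSL2 x * A * (lowerSL2 x)⁻¹)) = toQuot I (E A) := by
  have := commute_root hI hsr (hE.mem I A hA) ψ x
  rw [map_mul, map_mul, map_inv, map_mul, map_mul, map_inv, hE.lower, ← this.eq,
    mul_inv_cancel_right]

theorem toQuot_lower_mul (hE : IsRootEmbedding E φ ψ) {y : R} (hy : y ∈ I) (A : SL(2, R)) :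
    toQuot I (E (lowerSL2 y * A)) = toQuot I (E A) := by
  rw [map_mul, hE.lower, toQuot_root_mul _ hy]

theorem toQuot_mul_upper (hE : IsRootEmbedding E φ ψ) {y : R} (hy : y ∈ I) (A : SL(2, R)) :
    toQuot I (E (A * upperSL2 y)) = toQuot I (E A) := by
  rw [map_mul, hE.upper, map_mul, toQuot_root _ hy, mul_one]

theorem toQuot_eq_of_column (hE : IsRootEmbedding E φ ψ) {A B : SL(2, R)}
    (hA : A ∈ congruenceSL2 I) (hB : B ∈ congruenceSL2 I) (h0 : A 0 0 = B 0 0)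
    (h1 : A 1 0 = B 1 0) : toQuot I (E A) = toQuot I (E B) := by
  obtain ⟨y, hy, rfl⟩ := exists_mul_upperSL2 hA hB h0 h1
  rw [hE.toQuot_mul_upper hy]

theorem toQuot_eq_of_row (hE : IsRootEmbedding E φ ψ) {A B : SL(2, R)}
    (hA : A ∈ congruenceSL2 I) (hB : B ∈ congruenceSL2 I) (h0 : A 0 0 = B 0 0)
    (h1 : A 0 1 = B 0 1) : toQuot I (E A) = toQuot I (E B) := by
  obtain ⟨y, hy, rfl⟩ := exists_lowerSL2_mul hA hB h0 h1
  rw [hE.toQuot_lower_mul hy]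

open Classical in
/-- The class in `C(C₂, R, I) / E(C₂, R, I)` of the image under `E` of any matrix in
`SL₂(R, I)` with first column `(a, c)`; it is `1` if there is no such matrix. -/
noncomputable def symbol (hE : IsRootEmbedding E φ ψ) (I : Ideal R) (c a : R) :
    CongruenceQuotientSp4 I :=
  if h : ∃ A ∈ congruenceSL2 I, A 0 0 = a ∧ A 1 0 = c then
    QuotientGroup.mk ⟨E h.choose, hE.mem I _ h.choose_spec.1⟩
  else 1

theorem symbol_apply (hE : IsRootEmbedding E φ ψ) {A : SL(2, R)} (hA : A ∈ congruenceSL2 I) :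
    hE.symbol I (A 1 0) (A 0 0) = QuotientGroup.mk ⟨E A, hE.mem I A hA⟩ := by
  have h : ∃ B ∈ congruenceSL2 I, B 0 0 = A 0 0 ∧ B 1 0 = A 1 0 := ⟨A, hA, rfl, rfl⟩
  rw [symbol, dif_pos h, mk_eq_mk_iff]
  exact hE.toQuot_eq_of_column h.choose_spec.1 hA h.choose_spec.2.1 h.choose_spec.2.2

theorem symbol_eq_symbol (hE : IsRootEmbedding E φ ψ) {A B : SL(2, R)}
    (hA : A ∈ congruenceSL2 I) (hB : B ∈ congruenceSL2 I)
    (h : toQuot I (E A) = toQuot I (E B)) :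
    hE.symbol I (A 1 0) (A 0 0) = hE.symbol I (B 1 0) (B 0 0) := by
  rw [hE.symbol_apply hA, hE.symbol_apply hB, mk_eq_mk_iff]
  exact h

theorem isSymbol_symbol (hE : IsRootEmbedding E φ ψ) {q : R} (hI : Ideal.span {q} ≠ ⊥)
    (hsr : StableRangeLEThreeHalves R) :
    letI := quotientCommGroup hI hsr
    IsSymbol q (hE.symbol (Ideal.span {q})) := by
  let := quotientCommGroup hI hsr
  refine ⟨?_, ?_, ?_⟩
  · intro c a x h
    obtain ⟨A, hA, rfl, rfl⟩ := h.exists_matrix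
    have hB : upperSL2 x * A * (upperSL2 x)⁻¹ ∈ congruenceSL2 (Ideal.span {q}) :=
      congruenceSL2_normal.conj_mem A hA _
    have := hE.symbol_eq_symbol hB hA (hE.toQuot_upper_conj hI hsr hA x)
    rw [← upperSL2_neg] at this
    rwa [(mul_upperSL2 _ _).1, (mul_upperSL2 _ _).2.2.1, (upperSL2_mul _ _).1,
      (upperSL2_mul _ _).2.2.1] at this
  · intro c a y h
    obtain ⟨A, hA, rfl, rfl⟩ := h.exists_matrix
    have hy : q * y ∈ Ideal.span {q} := Ideal.mem_span_singleton.2 (dvd_mul_right q y)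
    have := hE.symbol_eq_symbol (mul_mem (lowerSL2_mem hy) hA) hA (hE.toQuot_lower_mul hy A)
    rwa [(lowerSL2_mul _ _).1, (lowerSL2_mul _ _).2.2.1, add_comm] at this
  · have := hE.symbol_apply (one_mem (congruenceSL2 (Ideal.span {q})))
    simp only [Matrix.SpecialLinearGroup.coe_one, Matrix.one_apply_eq, ne_eq, one_ne_zero,
      not_false_eq_true, Matrix.one_apply_ne] at this
    rw [this, QuotientGroup.eq_one_iff, Subgroup.mem_subgroupOf]
    change E 1 ∈ _
    rw [map_one]
    exact one_mem _

end IsRootEmbedding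

/-- The relation between the short and the long root subgroups. After a multiplication by a root
element, the product of the two matrices has first column `(a, 0, c² c', c c')`, which is cleared
by a long root matrix with first column `(a, c² c')`; what remains is elementary. -/
theorem toQuot_long_mul_short {A B P : SL(2, R)} (hA : A ∈ congruenceSL2 I)
    (hB : B ∈ congruenceSL2 I) (hP : P ∈ congruenceSL2 I) (hAB : A 0 0 = B 0 0)
    (hP0 : P 0 0 = B 0 0) (hP1 : P 1 0 = B 1 0 ^ 2 * A 1 0) :
    toQuot I (longEmb₁ A) * toQuot I (shortEmb B) = toQuot I (longEmb₁ P) := by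
  have dA := det_SL2 A
  have dB := det_SL2 B
  have dP := det_SL2 P
  have hc := (mem_congruenceSL2_iff.1 hB).2.2.1
  set g := rootElement .negShortDiff (-B 1 0) * (longEmb₂ A * shortEmb B) with hg
  have hgq : toQuot I g = toQuot I (longEmb₁ A) * toQuot I (shortEmb B) := by
    rw [hg, toQuot_root_mul _ (neg_mem hc), map_mul, toQuot_longEmb₂ hA]
  have hgm : g ∈ congruenceSp4 I := mul_mem (rootElement_mem_congruenceSp4 _ (neg_mem hc))
    (mul_mem (longEmb₂_mem hA) (shortEmb_mem hB))
  have g0 : g.1 (.inl 0) (.inl 0) = B 0 0 := by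
    simp [hg, Sp4.mul_apply, longEmb₂_val, shortEmb_val, rootElement_val, rootMatrix]
  have g1 : g.1 (.inl 1) (.inl 0) = 0 := by
    simp [hg, Sp4.mul_apply, longEmb₂_val, shortEmb_val, rootElement_val, rootMatrix, hAB]
    ring
  have g2 : g.1 (.inr 0) (.inl 0) = B 1 0 ^ 2 * A 1 0 := by
    simp [hg, Sp4.mul_apply, longEmb₂_val, shortEmb_val, rootElement_val, rootMatrix]
    ring
  have g11 : g.1 (.inl 1) (.inl 1) = 1 := by
    simp [hg, Sp4.mul_apply, longEmb₂_val, shortEmb_val, rootElement_val, rootMatrix, hAB]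
    linear_combination dB
  obtain ⟨f0, f2, f1, -⟩ := longEmb₁_inv_mul_apply P g (.inl 0)
  obtain ⟨-, -, f11, -⟩ := longEmb₁_inv_mul_apply P g (.inl 1)
  rw [g0, g2] at f0 f2
  obtain ⟨N, hN, hN0, hNq⟩ := exists_longEmb₁_of_column
    (mul_mem (longEmb₁_mem (inv_mem hP)) hgm)
    (by rw [f0, ← hP1, ← hP0]; linear_combination dP)
    (by rw [f2, hP1, hP0]; ring)
  rw [f11, f1, g1, g11, zero_mul, sub_zero] at hN0
  have hlow := (mem_congruenceSL2_iff.1 hN).2.2.1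
  have hN1 : toQuot I (longEmb₁ N) = 1 := by
    rw [isRootEmbedding_long.toQuot_eq_of_column hN (lowerSL2_mem hlow) hN0 rfl,
      isRootEmbedding_long.lower, toQuot_root _ hlow]
  rw [hN1, map_mul, map_inv, map_inv, inv_mul_eq_one] at hNq
  rw [← hgq, hNq]

theorem isSymbolPair_symbol {q : R} (hI : Ideal.span {q} ≠ ⊥)
    (hsr : StableRangeLEThreeHalves R) :
    letI := quotientCommGroup hI hsr
    IsSymbolPair q (isRootEmbedding_long.symbol (Ideal.span {q}))
      (isRootEmbedding_short.symbol (Ideal.span {q})) := by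
  let := quotientCommGroup hI hsr
  refine ⟨isRootEmbedding_long.isSymbol_symbol hI hsr, isRootEmbedding_short.isSymbol_symbol hI hsr,
    ?_, ?_, ?_, ?_⟩
  · intro c c' a h h'
    have h2 : IsColumn q (c ^ 2 * c') a := by
      rw [pow_two]; exact (h.mul_num h).mul_num h'
    obtain ⟨B, hB, hB0, hB1⟩ := h.exists_matrix
    obtain ⟨A, hA, hA0, hA1⟩ := h'.exists_matrix
    obtain ⟨P, hP, hP0, hP1⟩ := h2.exists_matrix
    have eB := isRootEmbedding_short.symbol_apply hB
    have eA := isRootEmbedding_long.symbol_apply hA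
    have eP := isRootEmbedding_long.symbol_apply hP
    rw [hB0, hB1] at eB
    rw [hA0, hA1] at eA
    rw [hP0, hP1] at eP
    rw [mul_comm, eA, eB, eP, ← QuotientGroup.mk_mul, mk_eq_mk_iff]
    simp only [Subgroup.coe_mul, map_mul]
    exact toQuot_long_mul_short hA hB hP (by rw [hA0, hB0]) (by rw [hP0, hB0])
      (by rw [hP1, hB1, hA1])
  · intro z
    obtain ⟨⟨g, hg⟩, rfl⟩ := QuotientGroup.mk_surjective z
    obtain ⟨N, hN, e⟩ := exists_longEmb₁ hI hsr hg
    refine ⟨N 1 0, N 0 0, isColumn_of_mem hN, ?_⟩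
    rw [isRootEmbedding_long.symbol_apply hN, mk_eq_mk_iff]
    exact e.symm
  · intro A hA B hB
    rw [isRootEmbedding_short.symbol_apply hA, isRootEmbedding_short.symbol_apply hB,
      isRootEmbedding_short.symbol_apply (mul_mem hA hB), ← QuotientGroup.mk_mul, mk_eq_mk_iff]
    simp only [Subgroup.coe_mul, map_mul]
  · intro A hA B hB h1 h0
    obtain ⟨x, hx⟩ := h0
    refine isRootEmbedding_short.symbol_eq_symbol hA hB ?_
    rw [← isRootEmbedding_short.toQuot_lower_conj hI hsr hA (-x), lowerSL2_neg, inv_inv,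
      ← lowerSL2_neg]
    refine isRootEmbedding_short.toQuot_eq_of_row ?_ hB ?_ ?_
    · rw [lowerSL2_neg]
      simpa using congruenceSL2_normal.conj_mem A hA (lowerSL2 x)⁻¹
    · rw [(mul_lowerSL2 _ _).1, (lowerSL2_mul _ _).1, (lowerSL2_mul _ _).2.1]
      linear_combination -hx
    · rw [(mul_lowerSL2 _ _).2.1, (lowerSL2_mul _ _).2.1, h1]

/-- A matrix in `SL₂(R, I)` can be moved into `SL₂(R, qR)` for any non-zero `q`: since `R/qR`
has stable range one, its corner may be assumed to be a unit modulo `q`, and then it is reduced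
to the identity modulo `q` by elementary matrices of `I` and their conjugates. -/
theorem exists_mem_congruenceSL2_span (hI : I ≠ ⊥) (hsr : StableRangeLEThreeHalves R) {q : R}
    (hq : q ≠ 0) {A : SL(2, R)} (hA : A ∈ congruenceSL2 I) :
    ∃ B ∈ congruenceSL2 (Ideal.span {q}), toQuot I (longEmb₁ B) = toQuot I (longEmb₁ A) := by
  have hE := isRootEmbedding_long (R := R)
  obtain ⟨x, p, r, hpr⟩ := hsr.exists_isCoprime (a := A 0 0) (b := A 0 1) hq
    ⟨A 1 1, -A 1 0, 0, by linear_combination det_SL2 A⟩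
  obtain ⟨A₁, hA₁, hq₁, h00⟩ : ∃ A₁ ∈ congruenceSL2 I,
      toQuot I (longEmb₁ A₁) = toQuot I (longEmb₁ A) ∧ p * A₁ 0 0 + r * q = 1 := by
    refine ⟨lowerSL2 (-x) * A * (lowerSL2 (-x))⁻¹, congruenceSL2_normal.conj_mem A hA _,
      hE.toQuot_lower_conj hI hsr hA (-x), ?_⟩
    rw [← lowerSL2_neg, neg_neg, (mul_lowerSL2 _ _).1, (lowerSL2_mul _ _).1,
      (lowerSL2_mul _ _).2.1]
    linear_combination hpr
  have hm₁ := mem_congruenceSL2_iff.1 hA₁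
  -- modulo `q` the first column of `A₂` is `(1 + i, -i)` with `i = A₁ 0 0 - 1`
  set i := A₁ 0 0 - 1 with hi
  set y := -(A₁ 1 0 + i) * p with hy
  have hyI : y ∈ I := I.mul_mem_right _ (neg_mem (add_mem hm₁.2.2.1 hm₁.1))
  set A₂ := lowerSL2 y * A₁ with hA₂
  have hA₂m : A₂ ∈ congruenceSL2 I := mul_mem (lowerSL2_mem hyI) hA₁
  have hq₂ : toQuot I (longEmb₁ A₂) = toQuot I (longEmb₁ A₁) := hE.toQuot_lower_mul hyI A₁
  have h2a : A₂ 0 0 = 1 + i := by rw [hA₂, (lowerSL2_mul _ _).1, hi]; ring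
  have h2c : A₂ 1 0 = -i + (A₁ 1 0 + i) * r * q := by
    rw [hA₂, (lowerSL2_mul _ _).2.2.1, hy]
    linear_combination -(A₁ 1 0 + i) * h00
  -- the conjugate of `lowerSL2 i` below maps `(1 + i, -i)` to `(1, 0)`
  set A₃ := upperSL2 (-1) * (lowerSL2 i * (upperSL2 1 * A₂)) with hA₃
  have hiI : i ∈ I := hm₁.1
  have hA₃e : A₃ = (upperSL2 (-1) * lowerSL2 i * (upperSL2 (-1))⁻¹) * A₂ := by
    rw [hA₃, ← upperSL2_neg, neg_neg]; group
  have hA₃m : A₃ ∈ congruenceSL2 I := by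
    rw [hA₃e]
    exact mul_mem (congruenceSL2_normal.conj_mem _ (lowerSL2_mem hiI) _) hA₂m
  have hq₃ : toQuot I (longEmb₁ A₃) = toQuot I (longEmb₁ A₂) := by
    rw [hA₃e, map_mul, map_mul, hE.toQuot_upper_conj hI hsr (lowerSL2_mem hiI), hE.lower,
      toQuot_root _ hiI, one_mul]
  have h3a : A₃ 0 0 = 1 + -(A₁ 1 0 + i) * r * i * q := by
    rw [hA₃]
    simp only [(upperSL2_mul _ _).1, (upperSL2_mul _ _).2.2.1, (lowerSL2_mul _ _).1,
      (lowerSL2_mul _ _).2.2.1, h2a, h2c]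
    ring
  have h3c : A₃ 1 0 = (1 + i) * (A₁ 1 0 + i) * r * q := by
    rw [hA₃]
    simp only [(upperSL2_mul _ _).1, (upperSL2_mul _ _).2.2.1, (lowerSL2_mul _ _).2.2.1, h2a, h2c]
    ring
  have hm₃ := mem_congruenceSL2_iff.1 hA₃m
  have d₃ := det_SL2 A₃
  refine ⟨A₃ * upperSL2 (-A₃ 0 1), ?_, ?_⟩
  · rw [mem_congruenceSL2_iff]
    obtain ⟨k0, k1, k2, k3⟩ := mul_upperSL2 A₃ (-A₃ 0 1)
    simp only [Ideal.mem_span_singleton]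
    rw [k0, k1, k2, k3]
    rw [h3a, h3c] at d₃
    rw [h3a, h3c]
    refine ⟨⟨-(A₁ 1 0 + i) * r * i, by ring⟩, ⟨(A₁ 1 0 + i) * r * i * A₃ 0 1, by ring⟩,
      ⟨(1 + i) * (A₁ 1 0 + i) * r, by ring⟩, ⟨(A₁ 1 0 + i) * r * i * A₃ 1 1, ?_⟩⟩
    linear_combination d₃
  · rw [hE.toQuot_mul_upper (neg_mem hm₃.2.1), hq₃, hq₂, hq₁]

theorem congruenceSp4_mono {I J : Ideal R} (h : I ≤ J) : congruenceSp4 I ≤ congruenceSp4 J :=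
  fun _ hg => mem_congruenceSp4_iff.2 fun i j => h (mem_congruenceSp4_iff.1 hg i j)

theorem elementarySp4_mono {I J : Ideal R} (h : I ≤ J) : elementarySp4 I ≤ elementarySp4 J :=
  Subgroup.normalClosure_mono fun _ ⟨φ, x, hx, e⟩ => ⟨φ, x, h hx, e⟩

/-- The quotient for `I` is an image of the quotient for `qR`, for any non-zero `q ∈ I`. -/
theorem exists_surjective_quotient (hI : I ≠ ⊥) (hsr : StableRangeLEThreeHalves R) {q : R}
    (hq : q ≠ 0) (hqI : q ∈ I) :
    ∃ f : CongruenceQuotientSp4 (Ideal.span {q}) → CongruenceQuotientSp4 I,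
      Function.Surjective f := by
  have hle : Ideal.span {q} ≤ I := (Ideal.span_singleton_le_iff_mem I).2 hqI
  refine ⟨QuotientGroup.map _ _ (Subgroup.inclusion (congruenceSp4_mono hle))
    fun g hg => elementarySp4_mono hle hg, fun z => ?_⟩
  obtain ⟨⟨g, hg⟩, rfl⟩ := QuotientGroup.mk_surjective z
  obtain ⟨A, hA, e⟩ := exists_longEmb₁ hI hsr hg
  obtain ⟨B, hB, e'⟩ := exists_mem_congruenceSL2_span hI hsr hq hA
  refine ⟨QuotientGroup.mk ⟨longEmb₁ B, longEmb₁_mem hB⟩, ?_⟩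
  exact mk_eq_mk_iff.2 (e'.trans e.symm)

end Classes

end CongruenceQuotient


theorem mainTheorem5 {R : Type*} [CommRing R] (I : Ideal R) (hI : I ≠ ⊥)
    (hsr : CongruenceQuotient.StableRangeLEThreeHalves R)
    (t l : ℕ) (ht : 0 < t) (hl : 0 < l)
    (hgen2 : CongruenceQuotient.GenProp R 2 1)
    (hgent : CongruenceQuotient.GenProp R t 1)
    (hexp : CongruenceQuotient.ExpProp R t l) :
    Finite (CongruenceQuotient.CongruenceQuotientSp4 I) ∧
      Nat.card (CongruenceQuotient.CongruenceQuotientSp4 I) ≤ 2 * t := by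
  obtain ⟨q, hqI, hq⟩ := Submodule.exists_mem_ne_zero_of_ne_bot hI
  have hqs : Ideal.span {q} ≠ ⊥ := by simpa using hq
  obtain ⟨f, hf⟩ := CongruenceQuotient.exists_surjective_quotient hI hsr hq hqI
  let := CongruenceQuotient.quotientCommGroup hqs hsr
  obtain ⟨hfin, hcard⟩ := (CongruenceQuotient.isSymbolPair_symbol hqs hsr).card_le hq hsr ht
    hgen2 hgent hexp
  exact ⟨Finite.of_surjective f hf, (Nat.card_le_card_of_surjective f hf).trans hcard⟩
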